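/- **Setting.** Let $U$ be a finite universe of size $N$. A dataset is $x=(x_1,\dots,x_n)\in U^n$; two datasets are neighbouring if they differ in exactly one entry. A Boolean statistical query is $q:U\to\{0,1\}$, with $q(x)=\frac1n\sum_{i}q(x_i)$; for $\mathcal Q=(q_1,\dots,q_m)$ put $\mathcal Q(x)=(q_1(x),\dots,q_m(x))$, and let $Q\in\{0,1\}^{m\times U}$ be the matrix whose rows are the truth tables of the $q_j$. A randomized algorithm $M$ on $U^n$ is $(\varepsilon,\delta)$-differentially private (DP) if $\Pr[M(x)\in R]\le e^{\varepsilon}\Pr[M(x')\in R]+\delta$ for all neighbouring $x,x'$ and all measurable $R$. An interactive algorithm receives $x$ and then, in rounds $j=1,\dots,m$, receives a query $q_j$ and returns an answer $a_j\in\mathbb R$; an adaptive analyst chooses $q_j$, possibly at random, from the previous queries and answers. The interactive algorithm is $(\varepsilon,\delta)$-DP if for every adaptive analyst the transcript $(q_1,a_1,\dots,q_m,a_m)$ is an $(\varepsilon,\delta)$-DP function of $x$. For a matrix $B$ with columns indexed by $U$ let $$\mathrm{hdisc}(B,w)=\max_{S\subseteq U,\ |S|\le w}\ \min_{z\in\{\pm1\}^S}\|B_S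 z\|_\infty ,$$ and let $\mathrm{hdisc}^*(\mathcal Q,w)=\mathrm{hdisc}(Q^*,w)$, where $Q^*$ is $Q$ with the row $(1,\dots,1)$ appended. All logarithms are natural. Put $$F(\mathcal Q)=\frac{\sqrt{\mathrm{hdisc}^*(\mathcal Q,n)\,\log N\,\log(1/\delta)}\;\log\!\left(\frac{m\log n}{\beta}\right)\log n}{\varepsilon n}.$$ **Theorem.** (1) There is an absolute constant $k$, and for every $\delta_0\in(0,1)$ a constant $C>0$ depending only on $\delta_0$, such that for every finite $U$ and all $n\ge3$, $m\ge1$, $\varepsilon\in(0,1]$, $\delta\in(0,\delta_0]$, $\beta\in(0,1)$ there is an $(\varepsilon,\delta)$-differentially private interactive algorithm such that, for every dataset $x\in U^n$ and every adaptive analyst asking $m$ Boolean statistical queries, the queries $\mathcal Q=(q_1,\dots,q_m)$ asked and the answers $a=(a_1,\dots,a_m)$ satisfy, with probability at least $1-\beta$, $$\|\mathcal Q(x)-a\|_\infty\ \le\ C\,(1+\log\log n)^k\,F(\mathcal Q)^{2/3}.$$ (2) This is competitive with the offline discrepancy lower bound in the following sense. There is an absolute constant $c>0$ such that for every finite $U$,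 all $n\ge3$, $m\ge1$ and every sequence $\mathcal Q$ of $m$ Boolean statistical queries with $H:=\mathrm{hdisc}^*(\mathcal Q,n)\ge2$: for every $(\frac18,\frac18)$-differentially private (offline) algorithm $M_{\mathcal Q}:U^n\to\mathbb R^m$ there is a dataset $x\in U^n$ with $$\mathbb E\,\|\mathcal Q(x)-M_{\mathcal Q}(x)\|_\infty\ \ge\ c\,\frac{H}{n\log n},$$ and for all $\varepsilon>0$ and $\delta,\beta\in(0,1)$, $$\frac{H}{n}=F(\mathcal Q)^{2/3}\left(\frac{\varepsilon^2H^2}{n\,\log N\,\log(1/\delta)\,\log^2(\frac{m\log n}{\beta})\,\log^2 n}\right)^{1/3}.$$ -/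

import Mathlib

open MeasureTheory ProbabilityTheory

universe u

namespace OnlineRelease

noncomputable section

/-! ### Datasets, counting queries and differential privacy -/

/-- A dataset of `n` elements of the universe `U`. -/
abbrev Dataset (U : Type u) (n : ℕ) : Type u := Fin n → U

/-- A Boolean statistical query (a counting query). -/
abbrev BoolQuery (U : Type u) : Type u := U → Bool

/-- The entry `q u ∈ {0, 1}` of the truth table of `q`, as a real number. -/
def truth {U : Type u} (q : BoolQuery U) (u : U) : ℝ := if q u then 1 else 0

/-- `q(x) = (1/n) ∑ i, q(x i)`. -/
def queryValue {U : Type u} {n : ℕ} (q : BoolQuery U) (x : Dataset U n) : ℝ :=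
  (∑ i, truth q (x i)) / n

/-- Two datasets are neighbouring if they differ in exactly one data point. -/
def Neighboring {U : Type u} {n : ℕ} (x x' : Dataset U n) : Prop :=
  ∃ i, x i ≠ x' i ∧ ∀ j, j ≠ i → x j = x' j

/-- `(ε, δ)`-differential privacy of a randomized algorithm, given by its output laws. -/
def IsDP {U : Type u} {n : ℕ} {R : Type*} [MeasurableSpace R] (ε δ : ℝ)
    (M : Dataset U n → Measure R) : Prop :=
  ∀ x x' : Dataset U n, Neighboring x x' → ∀ s : Set R, MeasurableSet s →
    M x s ≤ ENNReal.ofReal (Real.exp ε) * M x' s + ENNReal.ofReal δ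

/-! ### Interactive algorithms, adaptive analysts, transcripts -/

/-- An interactive algorithm: it draws an initial internal state from the dataset, and on each
query it draws, from its current state and the query, a new state and a real answer. -/
structure InteractiveAlgorithm (U : Type u) (n : ℕ) where
  State : Type u
  [measurableSpace : MeasurableSpace State]
  init : Dataset U n → Measure State
  [init_prob : ∀ x, IsProbabilityMeasure (init x)]
  answer : Kernel (State × BoolQuery U) (State × ℝ)
  [answer_markov : IsMarkovKernel answer]

attribute [instance] InteractiveAlgorithm.measurableSpace InteractiveAlgorithm.init_prob
  InteractiveAlgorithm.answer_markov

/-- The record of the first `j` rounds: the queries asked, each with its answer. -/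
abbrev Transcript (U : Type u) (j : ℕ) : Type u := Fin j → BoolQuery U × ℝ

/-- An adaptive, possibly randomized, data analyst: the law of the next query is any measurable
function of the record of the previous rounds. -/
structure AdaptiveAnalyst (U : Type u) where
  next : ∀ j : ℕ, Kernel (Transcript U j) (BoolQuery U)
  [next_markov : ∀ j, IsMarkovKernel (next j)]

attribute [instance] AdaptiveAnalyst.next_markov

/-- Joint law, after `j` rounds on the dataset `x`, of the internal state of `M` and of the
record of the interaction between `M` and `A`. In each round the analyst draws a query from the
record, the algorithm draws an answer (and its new state), and both are appended. -/
def run {U : Type u} {n : ℕ} (M : InteractiveAlgorithm U n) (A : AdaptiveAnalyst U)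
    (x : Dataset U n) : ∀ j : ℕ, Measure (M.State × Transcript U j)
  | 0 => (M.init x).map (fun s => (s, Fin.elim0))
  | j + 1 =>
      ((run M A x j ⊗ₘ (A.next j).comap Prod.snd measurable_snd) ⊗ₘ
        M.answer.comap
          (fun p : (M.State × Transcript U j) × BoolQuery U => (p.1.1, p.2))
          (by fun_prop)).map
        (fun p => (p.2.1, Fin.snoc p.1.1.2 (p.1.2, p.2.2)))

/-- The law of the transcript of `m` rounds of interaction between `M` and `A` on `x`. -/
def trans {U : Type u} {n : ℕ} (M : InteractiveAlgorithm U n) (A : AdaptiveAnalyst U)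
    (m : ℕ) (x : Dataset U n) : Measure (Transcript U m) :=
  (run M A x m).map Prod.snd

/-- `M` is `(ε, δ)`-differentially private, for `m` queries and adaptive analysts. -/
def InteractiveAlgorithm.IsPrivate {U : Type u} {n : ℕ} (M : InteractiveAlgorithm U n)
    (m : ℕ) (ε δ : ℝ) : Prop :=
  ∀ A : AdaptiveAnalyst U, IsDP ε δ (trans M A m)

/-- The `ℓ_∞` error `‖Q(x) - a‖_∞` of answers `a` to the queries `Q` on the dataset `x`
(the norm on `Fin m → ℝ` is the maximum norm). -/
def maxError {U : Type u} {n m : ℕ} (Q : Fin m → BoolQuery U) (a : Fin m → ℝ)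
    (x : Dataset U n) : ℝ :=
  ‖fun j => queryValue (Q j) x - a j‖

/-! ### Hereditary discrepancy -/

/-- The query matrix, whose rows are the truth tables of the queries. -/
def queryMatrix {U : Type u} {m : ℕ} (Q : Fin m → BoolQuery U) : Matrix (Fin m) U ℝ :=
  Matrix.of fun j u => truth (Q j) u

/-- Restricted hereditary discrepancy: the maximum over sets `S` of at most `w` columns of the
minimum over `x ∈ {±1}^S` of `‖Q_S x‖_∞`. -/
def hdisc {U : Type u} {k : ℕ} (Q : Matrix (Fin k) U ℝ) (w : ℕ) : ℝ :=
  ⨆ S : {S : Finset U // S.card ≤ w}, ⨅ x : S.1 → ℤˣ,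
    ‖(Q.submatrix id (Subtype.val : S.1 → U)).mulVec (fun v => (((x v : ℤˣ) : ℤ) : ℝ))‖

/-- The matrix `Q*`: `Q` with the row `(1, …, 1)` appended. -/
def appendOnes {U : Type u} {k : ℕ} (Q : Matrix (Fin k) U ℝ) : Matrix (Fin (k + 1)) U ℝ :=
  Matrix.of (Fin.snoc (α := fun _ => U → ℝ) (fun j => Q j) (fun _ => 1))

/-- Modified restricted hereditary discrepancy `hdisc*(Q, w) = hdisc(Q*, w)` of a sequence of
counting queries. -/
def hdiscStar {U : Type u} {m : ℕ} (Q : Fin m → BoolQuery U) (w : ℕ) : ℝ :=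
  hdisc (appendOnes (queryMatrix Q)) w

/-! ### The error rate -/

/-- `√(H log N log(1/δ)) · log(m log n / β) · log n / (ε n)`. -/
def errorRate (H : ℝ) (N n m : ℕ) (ε δ β : ℝ) : ℝ :=
  Real.sqrt (H * Real.log N * Real.log (1 / δ)) * Real.log (m * Real.log n / β) * Real.log n
    / (ε * n)

end

end OnlineRelease

/-!
The algorithm keeps a public set of candidate summaries of the dataset and predicts each query by
the median of its predictions. As long as the prediction is nearly right, it is the answer; how
far it may be off is governed by a hidden geometric counter, as in the sparse vector technique.
Otherwise a noisy count is published, which refutes at least half of the candidates, so that the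
public state changes rarely. Halving the dataset repeatedly along colourings of low discrepancy
yields a summary whose size is governed by `hdisc*`, hence few candidates suffice. The discrepancy
is not known in advance: stage `k` uses summaries of at most `2 ^ (k + 1)` points, and once all
candidates of a stage are refuted the next one begins. Privacy follows from Markov's inequality
for high moments of the likelihood ratio, which are controlled by a supermartingale whose budget
is spent when the public state changes.

For the lower bound, `9 log n` rounds of good partial colourings would colour everything well, so
some set of columns admits only bad partial colourings. Pair up its elements and encode a word by
taking from each pair the element that its bit selects. Two words which differ in many bits then
differ by a partial colouring, so some query separates their datasets: accurate answers determine
most of the bits of a word, which contradicts differential privacy.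
-/

open scoped ENNReal

universe v

namespace OnlineRelease

noncomputable section

/-! ### Mechanisms with a public state and a hidden counter -/

theorem Neighboring.symm {U : Type u} {n : ℕ} {x x' : Dataset U n} (h : Neighboring x x') :
    Neighboring x' x := by
  obtain ⟨i, hne, heq⟩ := h
  exact ⟨i, hne.symm, fun j hj => (heq j hj).symm⟩

theorem lintegral_toMeasure {α : Type*} [MeasurableSpace α] (p : PMF α) {ψ : α → ℝ≥0∞}
    (hψ : Measurable ψ) : ∫⁻ a, ψ a ∂p.toMeasure = ∑' a, p a * ψ a := by
  have hsum : p.toMeasure = Measure.sum fun a => p a • Measure.dirac a := by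
    ext s hs
    rw [PMF.toMeasure_apply p hs, Measure.sum_apply _ hs]
    refine tsum_congr fun a => ?_
    by_cases ha : a ∈ s <;> simp [hs, ha]
  rw [hsum, lintegral_sum_measure]
  refine tsum_congr fun a => ?_
  rw [lintegral_smul_measure, lintegral_dirac' a hψ, smul_eq_mul]

theorem lintegral_toMeasure_map {α β : Type*} [MeasurableSpace β] (p : PMF α) (f : α → β)
    {ψ : β → ℝ≥0∞} (hψ : Measurable ψ) :
    ∫⁻ b, ψ b ∂(p.map f).toMeasure = ∑' a, p a * ψ (f a) := by
  let _ : MeasurableSpace α := ⊤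
  have hf : Measurable f := measurable_from_top
  rw [← PMF.toMeasure_map f p hf, lintegral_map hψ hf]
  exact lintegral_toMeasure p (hψ.comp hf)

/-- A randomized algorithm that answers queries from a public state, which everyone can compute from
the transcript, and a hidden counter. An outcome `none` leaves both unchanged; an outcome `some z`
updates the public state and draws the counter afresh. The data enter only through the law of the
outcome. -/
structure SparseMechanism (U : Type u) (n : ℕ) (Pub : Type u) (Z : Type*) where
  start : Pub
  fresh : Pub → PMF ℕ
  outcome : Dataset U n → Pub → BoolQuery U → ℕ → PMF (Option Z)
  next : Pub → BoolQuery U → Z → Pub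
  reply : Pub → BoolQuery U → Option Z → ℝ

/-- The queries and outcomes of the first `j` rounds, the last round being the outermost pair. -/
def History (U : Type u) (Z : Type v) : ℕ → Type (max u v)
  | 0 => PUnit
  | j + 1 => History U Z j × BoolQuery U × Option Z

instance instFintypeHistory {U Z : Type*} [Fintype U] [DecidableEq U] [Fintype Z] :
    ∀ j, Fintype (History U Z j)
  | 0 => inferInstanceAs (Fintype PUnit)
  | j + 1 =>
    letI := instFintypeHistory (U := U) (Z := Z) j
    inferInstanceAs (Fintype (History U Z j × BoolQuery U × Option Z))

section

variable {U Z : Type*} [Fintype U] [DecidableEq U] [Fintype Z] {β : Type*} [AddCommMonoid β]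

theorem sum_history_zero (f : History U Z 0 → β) : ∑ h, f h = f PUnit.unit :=
  Fintype.sum_unique (ι := PUnit) f

theorem sum_history_succ {j : ℕ} (f : History U Z (j + 1) → β) :
    ∑ h, f h = ∑ h : History U Z j, ∑ q : BoolQuery U, ∑ o : Option Z, f (h, q, o) :=
  (Fintype.sum_prod_type fun h : History U Z j × BoolQuery U × Option Z => f h).trans <|
    Finset.sum_congr rfl fun _ _ => Fintype.sum_prod_type _

end

namespace SparseMechanism

variable {U : Type u} {n : ℕ} {Pub : Type u} {Z : Type*} (M : SparseMechanism U n Pub Z)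

/-- The public state after a round with outcome `o`. -/
def move (σ : Pub) (q : BoolQuery U) (o : Option Z) : Pub := o.elim σ (M.next σ q)

/-- The law of the hidden counter after a round with outcome `o`. -/
def refresh (σ : Pub) (q : BoolQuery U) (r : ℕ) (o : Option Z) : PMF ℕ :=
  o.elim (PMF.pure r) fun z => M.fresh (M.next σ q z)

/-- The joint law of the outcome of a round and of the counter after it. -/
def step (x : Dataset U n) (σ : Pub) (q : BoolQuery U) (r : ℕ) : PMF (Option Z × ℕ) :=
  (M.outcome x σ q r).bind fun o => (M.refresh σ q r o).map (Prod.mk o)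

theorem step_apply (x : Dataset U n) (σ : Pub) (q : BoolQuery U) (r : ℕ) (o : Option Z) (r' : ℕ) :
    M.step x σ q r (o, r') = M.outcome x σ q r o * M.refresh σ q r o r' := by
  classical
  have hmap (o' : Option Z) : (M.refresh σ q r o').map (Prod.mk o') (o, r') =
      if o' = o then M.refresh σ q r o r' else 0 := by
    rw [PMF.map_apply]
    by_cases ho : o' = o
    · subst ho
      rw [tsum_eq_single r' fun s hs => by simp [hs.symm]]
      simp
    · simp [ho, Ne.symm ho]
  simp [step, PMF.bind_apply, hmap]

/-- The interactive algorithm carried out by the mechanism; its state also holds the dataset. -/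
def algorithm [Finite U] [Countable Pub] : InteractiveAlgorithm U n where
  State := Dataset U n × Pub × ℕ
  measurableSpace := ⊤
  init x := letI : MeasurableSpace (Dataset U n × Pub × ℕ) := ⊤
    ((M.fresh M.start).map fun r => (x, M.start, r)).toMeasure
  init_prob _ := inferInstance
  answer := letI : MeasurableSpace (Dataset U n × Pub × ℕ) := ⊤
    Kernel.ofFunOfCountable fun p =>
      ((M.step p.1.1 p.1.2.1 p.2 p.1.2.2).map fun r =>
        (((p.1.1, M.move p.1.2.1 p.2 r.1, r.2) : Dataset U n × Pub × ℕ),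
          M.reply p.1.2.1 p.2 r.1)).toMeasure
  answer_markov := letI : MeasurableSpace (Dataset U n × Pub × ℕ) := ⊤
    ⟨fun _ => PMF.toMeasure.isProbabilityMeasure _⟩

/-- The public state after the rounds of a history. -/
def pub : ∀ j, History U Z j → Pub
  | 0, _ => M.start
  | j + 1, (h, q, o) => M.move (pub j h) q o

/-- The transcript of a history. -/
def record : ∀ j, History U Z j → Transcript U j
  | 0, _ => Fin.elim0
  | j + 1, (h, q, o) => Fin.snoc (record j h) (q, M.reply (M.pub j h) q o)

/-- The joint law of the history of `j` rounds and of the hidden counter after them. -/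
def law (A : AdaptiveAnalyst U) (x : Dataset U n) : ∀ j, History U Z j → ℕ → ℝ≥0∞
  | 0, _, r => M.fresh M.start r
  | j + 1, (h, q, o), r' => ∑' r, law A x j h r *
      (A.next j (M.record j h) {q} * M.step x (M.pub j h) q r (o, r'))

end SparseMechanism

section

variable {U : Type u} {n : ℕ} (M : InteractiveAlgorithm U n) (A : AdaptiveAnalyst U)
  (x : Dataset U n)

@[fun_prop]
theorem measurable_snoc_transcript {α : Type*} [MeasurableSpace α] {j : ℕ}
    {t : α → Transcript U j} {a : α → BoolQuery U × ℝ} (ht : Measurable t) (ha : Measurable a) :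
    Measurable fun p => (Fin.snoc (t p) (a p) : Transcript U (j + 1)) := by
  refine measurable_pi_iff.2 fun i => Fin.lastCases ?_ (fun i => ?_) i
  · simpa only [Fin.snoc_last]
  · simp only [Fin.snoc_castSucc]
    fun_prop

instance isProbabilityMeasure_run : ∀ j, IsProbabilityMeasure (run M A x j)
  | 0 => by
    rw [run]
    exact Measure.isProbabilityMeasure_map (by fun_prop)
  | j + 1 => by
    have := isProbabilityMeasure_run j
    rw [run]
    exact Measure.isProbabilityMeasure_map (by fun_prop)

variable {j : ℕ} {ψ : M.State × Transcript U (j + 1) → ℝ≥0∞}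

theorem lintegral_run_succ (hψ : Measurable ψ) :
    ∫⁻ p, ψ p ∂(run M A x (j + 1)) =
      ∫⁻ p, ∫⁻ q, ∫⁻ r, ψ (r.1, Fin.snoc p.2 (q, r.2)) ∂(M.answer (p.1, q))
        ∂(A.next j p.2) ∂(run M A x j) := by
  have hround : Measurable fun p : ((M.State × Transcript U j) × BoolQuery U) × (M.State × ℝ) =>
      ψ (p.2.1, Fin.snoc p.1.1.2 (p.1.2, p.2.2)) := by fun_prop
  rw [run, lintegral_map hψ (by fun_prop), Measure.lintegral_compProd hround]
  exact Measure.lintegral_compProd hround.lintegral_kernel_prod_right'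

theorem measurable_lintegral_round (hψ : Measurable ψ) :
    Measurable fun p : M.State × Transcript U j =>
      ∫⁻ q, ∫⁻ r, ψ (r.1, Fin.snoc p.2 (q, r.2)) ∂(M.answer (p.1, q)) ∂(A.next j p.2) := by
  have hround : Measurable fun p : ((M.State × Transcript U j) × BoolQuery U) × (M.State × ℝ) =>
      ψ (p.2.1, Fin.snoc p.1.1.2 (p.1.2, p.2.2)) := by fun_prop
  have hanswer := hround.lintegral_kernel_prod_right' (κ := M.answer.comap
    (fun p : (M.State × Transcript U j) × BoolQuery U => (p.1.1, p.2)) (by fun_prop))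
  exact hanswer.lintegral_kernel_prod_right' (κ := (A.next j).comap Prod.snd measurable_snd)

end

namespace SparseMechanism

variable {U : Type u} {n : ℕ} {Pub : Type u} {Z : Type*} (M : SparseMechanism U n Pub Z)
  [Countable Pub]

theorem lintegral_answer [Finite U] (x : Dataset U n) (σ : Pub) (q : BoolQuery U) (r : ℕ)
    {ψ : M.algorithm.State × ℝ → ℝ≥0∞} (hψ : Measurable ψ) :
    ∫⁻ p, ψ p ∂(M.algorithm.answer ((x, σ, r), q)) =
      ∑' p : Option Z × ℕ, M.step x σ q r p *
        ψ ((x, M.move σ q p.1, p.2), M.reply σ q p.1) :=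
  lintegral_toMeasure_map _ _ hψ

variable [Fintype U] [DecidableEq U] [Fintype Z]

theorem lintegral_round (A : AdaptiveAnalyst U) (x : Dataset U n) {j : ℕ} (h : History U Z j)
    (r : ℕ) {ψ : M.algorithm.State × Transcript U (j + 1) → ℝ≥0∞} (hψ : Measurable ψ) :
    ∫⁻ q, ∫⁻ p, ψ (p.1, Fin.snoc (M.record j h) (q, p.2))
        ∂(M.algorithm.answer ((x, M.pub j h, r), q)) ∂(A.next j (M.record j h)) =
      ∑ q : BoolQuery U, ∑ o : Option Z, ∑' r',
        A.next j (M.record j h) {q} * M.step x (M.pub j h) q r (o, r') *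
          ψ ((x, M.pub (j + 1) (h, q, o), r'), M.record (j + 1) (h, q, o)) := by
  rw [lintegral_fintype]
  refine Finset.sum_congr rfl fun q _ => ?_
  rw [M.lintegral_answer _ _ _ _ (by fun_prop), ENNReal.tsum_prod', tsum_fintype, Finset.sum_mul]
  refine Finset.sum_congr rfl fun o _ => ?_
  rw [← ENNReal.tsum_mul_right]
  refine tsum_congr fun r' => ?_
  rw [mul_comm (A.next j (M.record j h) {q}), mul_right_comm]
  rfl

theorem lintegral_run (A : AdaptiveAnalyst U) (x : Dataset U n) :
    ∀ (j : ℕ) {ψ : M.algorithm.State × Transcript U j → ℝ≥0∞}, Measurable ψ →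
      ∫⁻ p, ψ p ∂(run M.algorithm A x j) =
        ∑ h : History U Z j, ∑' r, M.law A x j h r * ψ ((x, M.pub j h, r), M.record j h)
  | 0, ψ, hψ => by
    rw [run, lintegral_map hψ (by fun_prop), sum_history_zero]
    exact lintegral_toMeasure_map (M.fresh M.start) _ (by fun_prop)
  | j + 1, ψ, hψ => by
    rw [lintegral_run_succ _ _ _ hψ, lintegral_run A x j (measurable_lintegral_round _ _ hψ),
      sum_history_succ]
    refine Finset.sum_congr rfl fun h _ => ?_
    simp_rw [M.lintegral_round A x h _ hψ, Finset.mul_sum]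
    rw [Summable.tsum_finsetSum fun _ _ => ENNReal.summable]
    refine Finset.sum_congr rfl fun q _ => ?_
    rw [Summable.tsum_finsetSum fun _ _ => ENNReal.summable]
    refine Finset.sum_congr rfl fun o _ => ?_
    simp_rw [← ENNReal.tsum_mul_left]
    rw [ENNReal.tsum_comm]
    refine tsum_congr fun r' => ?_
    simp_rw [← mul_assoc, ENNReal.tsum_mul_right]
    simp only [law, mul_assoc]

theorem trans_apply (A : AdaptiveAnalyst U) (x : Dataset U n) (j : ℕ)
    {s : Set (Transcript U j)} (hs : MeasurableSet s) :
    trans M.algorithm A j x s =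
      ∑ h : History U Z j, (∑' r, M.law A x j h r) * s.indicator 1 (M.record j h) := by
  have hind : Measurable (s.indicator (1 : Transcript U j → ℝ≥0∞)) := measurable_one.indicator hs
  rw [trans, ← lintegral_indicator_one hs, lintegral_map hind measurable_snd,
    M.lintegral_run A x j (by fun_prop)]
  exact Finset.sum_congr rfl fun _ _ => ENNReal.tsum_mul_right (a := s.indicator 1 _)

end SparseMechanism

/-! ### Moments of likelihood ratios -/

/-- The contribution `y (y / z) ^ l` of an outcome to the `l`-th moment of the likelihood ratio. -/
def ratioMoment (l : ℕ) (y z : ℝ) : ℝ := y ^ (l + 1) / z ^ l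

theorem ratioMoment_mul (l : ℕ) (y z y' z' : ℝ) :
    ratioMoment l (y * y') (z * z') = ratioMoment l y z * ratioMoment l y' z' := by
  simp only [ratioMoment, mul_pow, mul_div_mul_comm]

theorem ratioMoment_nonneg (l : ℕ) {y z : ℝ} (hy : 0 ≤ y) (hz : 0 ≤ z) :
    0 ≤ ratioMoment l y z := by
  unfold ratioMoment; positivity

theorem ratioMoment_self (l : ℕ) (y : ℝ) : ratioMoment l y y = y := by
  rcases eq_or_ne y 0 with rfl | hy
  · simp [ratioMoment]
  · rw [ratioMoment, pow_succ', mul_div_cancel_right₀ _ (pow_ne_zero l hy)]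

theorem le_exp_mul_add_ratioMoment (l : ℕ) (ε : ℝ) {y z : ℝ} (hy : 0 ≤ y) (hz : 0 ≤ z)
    (hac : z = 0 → y = 0) :
    y ≤ Real.exp ε * z + Real.exp (-(l * ε)) * ratioMoment l y z := by
  rcases le_or_gt y (Real.exp ε * z) with hyz | hyz
  · exact le_add_of_le_of_nonneg hyz (mul_nonneg (Real.exp_pos _).le (ratioMoment_nonneg l hy hz))
  have hz_pos : 0 < z := hz.lt_of_ne fun hz0 => by simp [hac hz0.symm, ← hz0] at hyz
  have hpow : Real.exp (l * ε) * z ^ l ≤ y ^ l := by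
    rw [Real.exp_nat_mul, ← mul_pow]
    exact pow_le_pow_left₀ (by positivity) hyz.le l
  refine le_add_of_nonneg_of_le (by positivity) ?_
  rw [ratioMoment, Real.exp_neg, ← div_eq_inv_mul, div_div, le_div_iff₀ (by positivity), pow_succ',
    mul_comm (z ^ l)]
  exact mul_le_mul_of_nonneg_left hpow hy

/-- The chord of `r ↦ r ^ (l + 1)` over `[exp (-η), exp η]`, homogenized by `r = y / z`. It is
linear in `(y, z)`, so that it can be summed over the outcomes of a round. -/
def chordBound (l : ℕ) (η y z : ℝ) : ℝ :=
  ((Real.exp η * z - y) * Real.exp (-η) ^ (l + 1) +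
    (y - Real.exp (-η) * z) * Real.exp η ^ (l + 1)) / (Real.exp η - Real.exp (-η))

theorem sum_chordBound {ι : Type*} (s : Finset ι) (l : ℕ) (η : ℝ) (y z : ι → ℝ) :
    ∑ i ∈ s, chordBound l η (y i) (z i) = chordBound l η (∑ i ∈ s, y i) (∑ i ∈ s, z i) := by
  simp only [chordBound, ← Finset.sum_div, Finset.sum_add_distrib, ← Finset.sum_mul,
    Finset.sum_sub_distrib, ← Finset.mul_sum]

theorem ratioMoment_le_chordBound (l : ℕ) {η y z : ℝ} (hη : 0 < η) (hz : 0 ≤ z)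
    (hyz : y ≤ Real.exp η * z) (hzy : z ≤ Real.exp η * y) :
    ratioMoment l y z ≤ chordBound l η y z := by
  have hwidth : 0 < Real.exp η - Real.exp (-η) := sub_pos.2 (Real.exp_lt_exp.2 (by linarith))
  rcases hz.eq_or_lt with rfl | hz
  · have hy : y = 0 := by
      have := (mul_nonneg_iff_of_pos_left (Real.exp_pos η)).1 hzy
      linarith
    simp [hy, ratioMoment, chordBound]
  obtain ⟨r, rfl⟩ : ∃ r, y = r * z := ⟨y / z, (div_mul_cancel₀ y hz.ne').symm⟩
  have hr_le : r ≤ Real.exp η := le_of_mul_le_mul_right hyz hz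
  have le_hr : Real.exp (-η) ≤ r := by
    rw [← mul_assoc] at hzy
    rw [Real.exp_neg, inv_le_iff_one_le_mul₀' (Real.exp_pos η)]
    exact (le_mul_iff_one_le_left hz).1 hzy
  have hconvex := (convexOn_pow (𝕜 := ℝ) (l + 1)).2
    (Set.mem_Ici.2 (Real.exp_pos (-η)).le) (Set.mem_Ici.2 (Real.exp_pos η).le)
    (div_nonneg (sub_nonneg.2 hr_le) hwidth.le) (div_nonneg (sub_nonneg.2 le_hr) hwidth.le) (by
      rw [← add_div, div_eq_one_iff_eq hwidth.ne']; ring)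
  simp only [smul_eq_mul] at hconvex
  calc ratioMoment l (r * z) z = z * r ^ (l + 1) := by
        rw [ratioMoment, mul_pow, pow_succ z l]; field_simp
    _ = z * ((Real.exp η - r) / (Real.exp η - Real.exp (-η)) * Real.exp (-η) +
          (r - Real.exp (-η)) / (Real.exp η - Real.exp (-η)) * Real.exp η) ^ (l + 1) := by
        congr 2; field_simp; ring
    _ ≤ z * ((Real.exp η - r) / (Real.exp η - Real.exp (-η)) * Real.exp (-η) ^ (l + 1) +
          (r - Real.exp (-η)) / (Real.exp η - Real.exp (-η)) * Real.exp η ^ (l + 1)) :=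
        mul_le_mul_of_nonneg_left hconvex hz.le
    _ = chordBound l η (r * z) z := by rw [chordBound]; ring

/-- An upper bound for the logarithm of the `l`-th moment of a likelihood ratio which takes values
in `[exp (-η), exp η]`. -/
def momentCost (l : ℕ) (η : ℝ) : ℝ := (l + 1) ^ 2 * η ^ 2 / 2

theorem momentCost_nonneg (l : ℕ) (η : ℝ) : 0 ≤ momentCost l η := by
  unfold momentCost
  positivity

theorem chordBound_one_one (l : ℕ) {η : ℝ} (hη : 0 < η) :
    chordBound l η 1 1 = Real.cosh ((l + 1 / 2) * η) / Real.cosh (η / 2) := by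
  have hwidth : 0 < Real.exp η - Real.exp (-η) := sub_pos.2 (Real.exp_lt_exp.2 (by linarith))
  have hsquare (t : ℝ) : Real.exp t = Real.exp (t / 2) ^ 2 := by
    rw [← Real.exp_nat_mul]; congr 1; push_cast; ring
  have hpow : Real.exp ((l + 1 / 2) * η) = Real.exp (η / 2) ^ (2 * l + 1) := by
    rw [← Real.exp_nat_mul]; congr 1; push_cast; ring
  rw [chordBound, div_eq_div_iff hwidth.ne' (Real.cosh_pos _).ne', Real.cosh_eq, Real.cosh_eq,
    Real.exp_neg ((l + 1 / 2) * η), Real.exp_neg (η / 2), Real.exp_neg η, hpow, hsquare η]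
  have hpos := Real.exp_pos (η / 2)
  generalize Real.exp (η / 2) = c at hpos
  simp only [inv_pow]
  field_simp
  ring

theorem chordBound_one_one_le (l : ℕ) {η : ℝ} (hη : 0 < η) :
    chordBound l η 1 1 ≤ Real.exp (momentCost l η) := by
  rw [chordBound_one_one l hη]
  calc Real.cosh ((l + 1 / 2) * η) / Real.cosh (η / 2)
      ≤ Real.cosh ((l + 1 / 2) * η) := div_le_self (Real.cosh_pos _).le (Real.one_le_cosh _)
    _ ≤ Real.exp (((l + 1 / 2) * η) ^ 2 / 2) := Real.cosh_le_exp_half_sq _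
    _ ≤ Real.exp (momentCost l η) := by
      rw [momentCost, mul_pow]
      gcongr
      norm_num

theorem toReal_le_of_le_ofReal_mul {a b : ℝ≥0∞} {c : ℝ} (hc : 0 ≤ c) (hb : b ≠ ⊤)
    (h : a ≤ ENNReal.ofReal c * b) : a.toReal ≤ c * b.toReal := by
  have := ENNReal.toReal_mono (ENNReal.mul_ne_top ENNReal.ofReal_ne_top hb) h
  rwa [ENNReal.toReal_mul, ENNReal.toReal_ofReal hc] at this

theorem ratioMoment_toReal_le_chordBound (l : ℕ) {η : ℝ} (hη : 0 < η) {a b : ℝ≥0∞} (ha : a ≠ ⊤)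
    (hb : b ≠ ⊤) (hab : a ≤ ENNReal.ofReal (Real.exp η) * b)
    (hba : b ≤ ENNReal.ofReal (Real.exp η) * a) :
    ratioMoment l a.toReal b.toReal ≤ chordBound l η a.toReal b.toReal :=
  ratioMoment_le_chordBound l hη ENNReal.toReal_nonneg
    (toReal_le_of_le_ofReal_mul (Real.exp_pos η).le hb hab)
    (toReal_le_of_le_ofReal_mul (Real.exp_pos η).le ha hba)

theorem le_exp_mul_add_ofReal_ratioMoment (l : ℕ) (ε : ℝ) {p p' : ℝ≥0∞} (hp : p ≠ ⊤)
    (hp' : p' ≠ ⊤) (hac : p' = 0 → p = 0) :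
    p ≤ ENNReal.ofReal (Real.exp ε) * p' +
      ENNReal.ofReal (Real.exp (-(l * ε)) * ratioMoment l p.toReal p'.toReal) := by
  have hac' (h : p'.toReal = 0) : p.toReal = 0 := by
    simp [hac (((ENNReal.toReal_eq_zero_iff _).1 h).resolve_right hp')]
  have hmoment := ratioMoment_nonneg l (ENNReal.toReal_nonneg (a := p))
    (ENNReal.toReal_nonneg (a := p'))
  calc p = ENNReal.ofReal p.toReal := (ENNReal.ofReal_toReal hp).symm
    _ ≤ ENNReal.ofReal (Real.exp ε * p'.toReal +
          Real.exp (-(l * ε)) * ratioMoment l p.toReal p'.toReal) :=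
        ENNReal.ofReal_le_ofReal <| le_exp_mul_add_ratioMoment l ε ENNReal.toReal_nonneg
          ENNReal.toReal_nonneg hac'
    _ = _ := by
        rw [ENNReal.ofReal_add (by positivity) (by positivity),
          ENNReal.ofReal_mul (Real.exp_pos ε).le, ENNReal.ofReal_toReal hp']

/-- Markov's inequality for the `l`-th moment: a likelihood ratio above `exp ε` contributes at least
`exp (l * ε)` times its probability to the moment. -/
theorem sum_mul_indicator_le_of_sum_ratioMoment_le {ι : Type*} [Fintype ι] {p p' : ι → ℝ≥0∞}
    (hp : ∀ i, p i ≠ ⊤) (hp' : ∀ i, p' i ≠ ⊤) (hac : ∀ i, p' i = 0 → p i = 0) {l : ℕ} {K : ℝ}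
    (hK : ∑ i, ratioMoment l (p i).toReal (p' i).toReal ≤ Real.exp K) (ε : ℝ) (s : Set ι) :
    ∑ i, p i * s.indicator 1 i ≤ ENNReal.ofReal (Real.exp ε) * ∑ i, p' i * s.indicator 1 i +
      ENNReal.ofReal (Real.exp (K - l * ε)) := by
  have hterm (i : ι) : p i * s.indicator 1 i ≤
      ENNReal.ofReal (Real.exp ε) * (p' i * s.indicator 1 i) +
        ENNReal.ofReal (Real.exp (-(l * ε)) * ratioMoment l (p i).toReal (p' i).toReal) := by
    by_cases hi : i ∈ s
    · simpa [hi] using le_exp_mul_add_ofReal_ratioMoment l ε (hp i) (hp' i) (hac i)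
    · simp [hi]
  refine (Finset.sum_le_sum fun i _ => hterm i).trans ?_
  rw [Finset.sum_add_distrib, ← Finset.mul_sum]
  gcongr
  rw [← ENNReal.ofReal_sum_of_nonneg fun i _ => mul_nonneg (Real.exp_pos _).le
    (ratioMoment_nonneg l ENNReal.toReal_nonneg ENNReal.toReal_nonneg), ← Finset.mul_sum]
  refine ENNReal.ofReal_le_ofReal ((mul_le_mul_of_nonneg_left hK (Real.exp_pos _).le).trans_eq ?_)
  rw [← Real.exp_add]
  ring_nf

/-! ### Privacy of a mechanism with a hidden counter -/

namespace SparseMechanism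

variable {U : Type u} {n : ℕ} {Pub : Type u} {Z : Type*} (M : SparseMechanism U n Pub Z)

/-- The likelihood of the outcomes since the last refresh of the counter, for each value of the
counter. -/
def weight (x : Dataset U n) : ∀ j, History U Z j → ℕ → ℝ≥0∞
  | 0, _, r => M.fresh M.start r
  | j + 1, (h, q, none), r => weight x j h r * M.outcome x (M.pub j h) q r none
  | j + 1, (h, q, some z), r => M.fresh (M.next (M.pub j h) q z) r

/-- The likelihood of the outcomes since the last refresh of the counter. -/
def segment (x : Dataset U n) (j : ℕ) (h : History U Z j) : ℝ≥0∞ := ∑' r, M.weight x j h r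

/-- The likelihood of the outcomes since the last refresh of the counter and of one more outcome. -/
def extend (x : Dataset U n) (j : ℕ) (h : History U Z j) (q : BoolQuery U) (o : Option Z) : ℝ≥0∞ :=
  ∑' r, M.weight x j h r * M.outcome x (M.pub j h) q r o

/-- The likelihood of all the queries and of the outcomes up to the last refresh of the counter. -/
def closed (A : AdaptiveAnalyst U) (x : Dataset U n) : ∀ j, History U Z j → ℝ≥0∞
  | 0, _ => 1
  | j + 1, (h, q, none) => A.next j (M.record j h) {q} * closed A x j h
  | j + 1, (h, q, some z) =>
    A.next j (M.record j h) {q} * (closed A x j h * M.extend x j h q (some z))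

theorem law_eq_closed_mul_weight (A : AdaptiveAnalyst U) (x : Dataset U n) :
    ∀ (j : ℕ) (h : History U Z j) (r : ℕ),
      M.law A x j h r = M.closed A x j h * M.weight x j h r
  | 0, _, r => (one_mul _).symm
  | j + 1, (h, q, none), r => by
    simp only [law, closed, weight, step_apply, refresh, Option.elim_none]
    rw [tsum_eq_single r fun r' hr' => by simp [hr'.symm], law_eq_closed_mul_weight A x j h r]
    simp only [PMF.pure_apply, if_true]
    ring
  | j + 1, (h, q, some z), r => by
    simp only [law, closed, weight, extend, step_apply, refresh, Option.elim_some]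
    simp_rw [law_eq_closed_mul_weight A x j h, ← ENNReal.tsum_mul_left, ← ENNReal.tsum_mul_right]
    exact tsum_congr fun r' => by ring

theorem tsum_law (A : AdaptiveAnalyst U) (x : Dataset U n) (j : ℕ) (h : History U Z j) :
    ∑' r, M.law A x j h r = M.closed A x j h * M.segment x j h := by
  simp_rw [law_eq_closed_mul_weight, segment, ENNReal.tsum_mul_left]

theorem segment_zero (x : Dataset U n) (h : History U Z 0) : M.segment x 0 h = 1 :=
  (M.fresh M.start).tsum_coe

theorem segment_some (x : Dataset U n) (j : ℕ) (h : History U Z j) (q : BoolQuery U) (z : Z) :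
    M.segment x (j + 1) (h, q, some z) = 1 :=
  (M.fresh (M.next (M.pub j h) q z)).tsum_coe

theorem extend_le_segment (x : Dataset U n) (j : ℕ) (h : History U Z j) (q : BoolQuery U)
    (o : Option Z) : M.extend x j h q o ≤ M.segment x j h :=
  ENNReal.tsum_le_tsum fun _ => mul_le_of_le_one_right' (PMF.coe_le_one _ _)

theorem sum_extend [Fintype Z] (x : Dataset U n) (j : ℕ) (h : History U Z j) (q : BoolQuery U) :
    ∑ o, M.extend x j h q o = M.segment x j h := by
  unfold extend segment
  refine (Summable.tsum_finsetSum fun _ _ => ENNReal.summable).symm.trans (tsum_congr fun r => ?_)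
  rw [← Finset.mul_sum, ← tsum_fintype (L := .unconditional _), PMF.tsum_coe, mul_one]

theorem segment_le_one (x : Dataset U n) : ∀ (j : ℕ) (h : History U Z j), M.segment x j h ≤ 1
  | 0, h => (M.segment_zero x h).le
  | j + 1, (h, q, none) => (M.extend_le_segment x j h q none).trans (segment_le_one x j h)
  | j + 1, (h, q, some z) => (M.segment_some x j h q z).le

theorem segment_ne_top (x : Dataset U n) (j : ℕ) (h : History U Z j) : M.segment x j h ≠ ⊤ :=
  ne_top_of_le_ne_top ENNReal.one_ne_top (M.segment_le_one x j h)

theorem extend_ne_top (x : Dataset U n) (j : ℕ) (h : History U Z j) (q : BoolQuery U)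
    (o : Option Z) : M.extend x j h q o ≠ ⊤ :=
  ne_top_of_le_ne_top (M.segment_ne_top x j h) (M.extend_le_segment x j h q o)

theorem closed_ne_top (A : AdaptiveAnalyst U) (x : Dataset U n) :
    ∀ (j : ℕ) (h : History U Z j), M.closed A x j h ≠ ⊤
  | 0, _ => ENNReal.one_ne_top
  | j + 1, (h, _, none) => ENNReal.mul_ne_top (measure_ne_top _ _) (closed_ne_top A x j h)
  | j + 1, (h, q, some z) => ENNReal.mul_ne_top (measure_ne_top _ _) <|
    ENNReal.mul_ne_top (closed_ne_top A x j h) (M.extend_ne_top x j h q (some z))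

/-- The behaviour of a mechanism on `x` is dominated by that on `x'` with the counter increased by
one, up to factors which depend exponentially on the privacy level `e` of the public state. -/
structure Dominated (e : Pub → ℝ) (x x' : Dataset U n) : Prop where
  fresh : ∀ σ r, M.fresh σ r ≤ ENNReal.ofReal (Real.exp (e σ)) * M.fresh σ (r + 1)
  stay : ∀ σ q r, M.outcome x σ q r none ≤ M.outcome x' σ q (r + 1) none
  change : ∀ σ q r z, M.outcome x σ q r (some z) ≤
    ENNReal.ofReal (Real.exp (4 * e σ)) * M.outcome x' σ q (r + 1) (some z)

section

theorem tsum_le_mul_tsum_of_shift {f g : ℕ → ℝ≥0∞} {c : ℝ≥0∞} (h : ∀ r, f r ≤ c * g (r + 1)) :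
    ∑' r, f r ≤ c * ∑' r, g r :=
  calc ∑' r, f r ≤ ∑' r, c * g (r + 1) := ENNReal.tsum_le_tsum h
    _ = c * ∑' r, g (r + 1) := ENNReal.tsum_mul_left
    _ ≤ c * ∑' r, g r :=
      mul_le_mul_right (ENNReal.tsum_comp_le_tsum_of_injective (add_left_injective 1) g) c

variable {M} {e : Pub → ℝ} {x x' : Dataset U n} (hd : M.Dominated e x x')

include hd

theorem Dominated.weight_le : ∀ (j : ℕ) (h : History U Z j) (r : ℕ),
    M.weight x j h r ≤ ENNReal.ofReal (Real.exp (e (M.pub j h))) * M.weight x' j h (r + 1)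
  | 0, _, r => hd.fresh _ r
  | j + 1, (h, q, none), r => by
    simp only [weight, ← mul_assoc]
    exact mul_le_mul' (weight_le j h r) (hd.stay _ q r)
  | j + 1, (h, q, some z), r => hd.fresh _ r

theorem Dominated.segment_le (j : ℕ) (h : History U Z j) (he : 0 < e (M.pub j h)) :
    M.segment x j h ≤ ENNReal.ofReal (Real.exp (5 * e (M.pub j h))) * M.segment x' j h :=
  (tsum_le_mul_tsum_of_shift (hd.weight_le j h)).trans <|
    mul_le_mul_left (ENNReal.ofReal_le_ofReal (Real.exp_le_exp.2 (by linarith))) _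

theorem Dominated.extend_le (j : ℕ) (h : History U Z j) (q : BoolQuery U) (z : Z) :
    M.extend x j h q (some z) ≤
      ENNReal.ofReal (Real.exp (5 * e (M.pub j h))) * M.extend x' j h q (some z) := by
  refine tsum_le_mul_tsum_of_shift fun r => ?_
  refine (mul_le_mul' (hd.weight_le j h r) (hd.change _ q r z)).trans_eq ?_
  rw [mul_mul_mul_comm, ← ENNReal.ofReal_mul (Real.exp_pos _).le, ← Real.exp_add]
  ring_nf

theorem Dominated.closed_eq_zero (A : AdaptiveAnalyst U) :
    ∀ (j : ℕ) (h : History U Z j), M.closed A x' j h = 0 → M.closed A x j h = 0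
  | 0, _, h0 => absurd h0 one_ne_zero
  | j + 1, (h, q, none), h0 => by
    simp only [closed, mul_eq_zero] at h0 ⊢
    exact h0.imp_right (closed_eq_zero A j h)
  | j + 1, (h, q, some z), h0 => by
    simp only [closed, mul_eq_zero] at h0 ⊢
    refine h0.imp_right (Or.imp (closed_eq_zero A j h) fun hz => ?_)
    simpa [hz] using hd.extend_le j h q z

end

/-- A budget for a mechanism with privacy level `e`: every change of the public state is paid for by
a decrease of the potential. -/
structure Budget (e : Pub → ℝ) (l : ℕ) (pot : Pub → ℝ) : Prop where
  pos : ∀ σ, 0 < e σ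
  le : ∀ σ, momentCost l (5 * e σ) ≤ pot σ
  next : ∀ σ q z, pot (M.next σ q z) + momentCost l (5 * e σ) ≤ pot σ

/-- The supermartingale which dominates the `l`-th moment of the likelihood ratio of a history: the
current segment enters through the chord bound, the future through the potential. -/
def majorant (e : Pub → ℝ) (l : ℕ) (pot : Pub → ℝ) (A : AdaptiveAnalyst U) (x x' : Dataset U n)
    (j : ℕ) (h : History U Z j) : ℝ :=
  ratioMoment l (M.closed A x j h).toReal (M.closed A x' j h).toReal *
    (chordBound l (5 * e (M.pub j h)) (M.segment x j h).toReal (M.segment x' j h).toReal *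
      Real.exp (pot (M.pub j h) - momentCost l (5 * e (M.pub j h))))

variable {M} {e pot : Pub → ℝ} {l : ℕ} {x x' : Dataset U n} (hB : M.Budget e l pot)

include hB

theorem Budget.chordBound_mul_exp_le (σ : Pub) :
    chordBound l (5 * e σ) 1 1 * Real.exp (pot σ - momentCost l (5 * e σ)) ≤ Real.exp (pot σ) :=
  calc _ ≤ Real.exp (momentCost l (5 * e σ)) * Real.exp (pot σ - momentCost l (5 * e σ)) := by
        gcongr
        exact chordBound_one_one_le l (mul_pos (by norm_num) (hB.pos σ))
    _ = Real.exp (pot σ) := by rw [← Real.exp_add, add_sub_cancel]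

theorem Budget.majorant_zero_le (A : AdaptiveAnalyst U) (h : History U Z 0) :
    M.majorant e l pot A x x' 0 h ≤ Real.exp (pot M.start) := by
  simpa [majorant, closed, pub, segment_zero, ratioMoment_self] using
    hB.chordBound_mul_exp_le M.start

variable (hd : M.Dominated e x x') (hd' : M.Dominated e x' x)

include hd hd'

theorem Budget.majorant_succ_le (A : AdaptiveAnalyst U) (j : ℕ) (h : History U Z j)
    (q : BoolQuery U) (o : Option Z) :
    M.majorant e l pot A x x' (j + 1) (h, q, o) ≤ (A.next j (M.record j h) {q}).toReal *
      (ratioMoment l (M.closed A x j h).toReal (M.closed A x' j h).toReal *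
        (chordBound l (5 * e (M.pub j h)) (M.extend x j h q o).toReal
            (M.extend x' j h q o).toReal *
          Real.exp (pot (M.pub j h) - momentCost l (5 * e (M.pub j h))))) := by
  rcases o with _ | z
  · simp only [majorant, closed, ENNReal.toReal_mul, ratioMoment_mul, ratioMoment_self, mul_assoc]
    rfl
  simp only [majorant, closed, segment_some, pub, move, Option.elim_some, ENNReal.toReal_mul,
    ENNReal.toReal_one, ratioMoment_mul, ratioMoment_self, mul_assoc]
  have hη : 0 < 5 * e (M.pub j h) := mul_pos (by norm_num) (hB.pos _)
  have hpay : chordBound l (5 * e (M.next (M.pub j h) q z)) 1 1 *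
        Real.exp (pot (M.next (M.pub j h) q z) - momentCost l (5 * e (M.next (M.pub j h) q z))) ≤
      Real.exp (pot (M.pub j h) - momentCost l (5 * e (M.pub j h))) :=
    (hB.chordBound_mul_exp_le _).trans <| Real.exp_le_exp.2 <|
      le_sub_iff_add_le.2 (hB.next (M.pub j h) q z)
  have hchord := ratioMoment_toReal_le_chordBound l hη (M.extend_ne_top x j h q (some z))
    (M.extend_ne_top x' j h q (some z)) (hd.extend_le j h q z) (hd'.extend_le j h q z)
  have hclosed := ratioMoment_nonneg l (ENNReal.toReal_nonneg (a := M.closed A x j h))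
    (ENNReal.toReal_nonneg (a := M.closed A x' j h))
  have hmoment := ratioMoment_nonneg l
    (ENNReal.toReal_nonneg (a := M.extend x j h q (some z)))
    (ENNReal.toReal_nonneg (a := M.extend x' j h q (some z)))
  refine mul_le_mul_of_nonneg_left (mul_le_mul_of_nonneg_left ?_ hclosed) ENNReal.toReal_nonneg
  exact (mul_le_mul_of_nonneg_left hpay hmoment).trans
    (mul_le_mul_of_nonneg_right hchord (Real.exp_pos _).le)

theorem Budget.ratioMoment_le_majorant (A : AdaptiveAnalyst U) (j : ℕ) (h : History U Z j) :
    ratioMoment l (M.closed A x j h * M.segment x j h).toReal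
      (M.closed A x' j h * M.segment x' j h).toReal ≤ M.majorant e l pot A x x' j h := by
  have hη : 0 < 5 * e (M.pub j h) := mul_pos (by norm_num) (hB.pos _)
  have hchord := ratioMoment_toReal_le_chordBound l hη (M.segment_ne_top x j h)
    (M.segment_ne_top x' j h) (hd.segment_le j h (hB.pos _)) (hd'.segment_le j h (hB.pos _))
  have hmoment := ratioMoment_nonneg l (ENNReal.toReal_nonneg (a := M.segment x j h))
    (ENNReal.toReal_nonneg (a := M.segment x' j h))
  have hpot : 1 ≤ Real.exp (pot (M.pub j h) - momentCost l (5 * e (M.pub j h))) :=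
    Real.one_le_exp (sub_nonneg.2 (hB.le (M.pub j h)))
  rw [ENNReal.toReal_mul, ENNReal.toReal_mul, ratioMoment_mul, majorant]
  refine mul_le_mul_of_nonneg_left ?_
    (ratioMoment_nonneg l ENNReal.toReal_nonneg ENNReal.toReal_nonneg)
  exact hchord.trans (le_mul_of_one_le_right (hmoment.trans hchord) hpot)

section

variable [Fintype U] [DecidableEq U] [Fintype Z]

theorem Budget.sum_majorant_succ_le (A : AdaptiveAnalyst U) (j : ℕ) (h : History U Z j) :
    ∑ q : BoolQuery U, ∑ o : Option Z, M.majorant e l pot A x x' (j + 1) (h, q, o) ≤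
      M.majorant e l pot A x x' j h := by
  have hround (q : BoolQuery U) : ∑ o, M.majorant e l pot A x x' (j + 1) (h, q, o) ≤
      (A.next j (M.record j h) {q}).toReal * M.majorant e l pot A x x' j h := by
    refine (Finset.sum_le_sum fun o _ => hB.majorant_succ_le hd hd' A j h q o).trans_eq ?_
    rw [← Finset.mul_sum, ← Finset.mul_sum, ← Finset.sum_mul, sum_chordBound,
      ← ENNReal.toReal_sum fun o _ => M.extend_ne_top x j h q o,
      ← ENNReal.toReal_sum fun o _ => M.extend_ne_top x' j h q o, M.sum_extend, M.sum_extend,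
      majorant]
  refine (Finset.sum_le_sum fun q _ => hround q).trans_eq ?_
  rw [← Finset.sum_mul, ← ENNReal.toReal_sum fun q _ => measure_ne_top _ _, sum_measure_singleton]
  simp

theorem Budget.sum_majorant_le (A : AdaptiveAnalyst U) (m : ℕ) :
    ∑ h : History U Z m, M.majorant e l pot A x x' m h ≤ Real.exp (pot M.start) := by
  induction m with
  | zero => exact (sum_history_zero _).trans_le (hB.majorant_zero_le A _)
  | succ j ih =>
    rw [sum_history_succ]
    exact (Finset.sum_le_sum fun h _ => hB.sum_majorant_succ_le hd hd' A j h).trans ih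

end

omit hd hd'

theorem Budget.isPrivate [Countable Pub] [Finite U] [Finite Z]
    (hd : ∀ x x', Neighboring x x' → M.Dominated e x x') {ε δ : ℝ}
    (hstart : Real.exp (pot M.start - l * ε) ≤ δ) (m : ℕ) :
    M.algorithm.IsPrivate m ε δ := by
  classical
  have _ := Fintype.ofFinite U
  have _ := Fintype.ofFinite Z
  intro A x x' hx s hs
  have hxx' := hd x x' hx
  have hfinite (y : Dataset U n) (h : History U Z m) :
      M.closed A y m h * M.segment y m h ≠ ⊤ :=
    ENNReal.mul_ne_top (M.closed_ne_top A y m h) (M.segment_ne_top y m h)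
  have hac (h : History U Z m) (h0 : M.closed A x' m h * M.segment x' m h = 0) :
      M.closed A x m h * M.segment x m h = 0 := by
    rw [mul_eq_zero] at h0 ⊢
    refine h0.imp (hxx'.closed_eq_zero A m h) fun hz => ?_
    simpa [hz] using hxx'.segment_le m h (hB.pos _)
  have hmoment : ∑ h : History U Z m, ratioMoment l (M.closed A x m h * M.segment x m h).toReal
      (M.closed A x' m h * M.segment x' m h).toReal ≤ Real.exp (pot M.start) :=
    (Finset.sum_le_sum fun h _ =>
      hB.ratioMoment_le_majorant hxx' (hd x' x hx.symm) A m h).trans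
      (hB.sum_majorant_le hxx' (hd x' x hx.symm) A m)
  rw [M.trans_apply A x m hs, M.trans_apply A x' m hs]
  simp_rw [tsum_law]
  exact (sum_mul_indicator_le_of_sum_ratioMoment_le (hfinite x) (hfinite x') hac hmoment ε
    (M.record m ⁻¹' s)).trans (add_le_add_right (ENNReal.ofReal_le_ofReal hstart) _)

end SparseMechanism

/-! ### Failure probabilities -/

section

variable {U : Type u} {n : ℕ} {M : InteractiveAlgorithm U n} {x : Dataset U n}
  {G : ∀ j, Set (M.State × Transcript U j)} {b₀ b : ℝ≥0∞}

theorem run_compl_le (hG : ∀ j, MeasurableSet (G j))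
    (hinit : M.init x {s | (s, Fin.elim0) ∉ G 0} ≤ b₀)
    (hstep : ∀ j p q, p ∈ G j →
      M.answer (p.1, q) {r | (r.1, Fin.snoc p.2 (q, r.2)) ∉ G (j + 1)} ≤ b)
    (A : AdaptiveAnalyst U) (j : ℕ) : run M A x j (G j)ᶜ ≤ b₀ + j * b := by
  induction j with
  | zero =>
    rw [run, Measure.map_apply (by fun_prop) (hG 0).compl]
    exact hinit.trans le_self_add
  | succ j ih =>
    have hind : Measurable ((G (j + 1))ᶜ.indicator (1 : M.State × Transcript U (j + 1) → ℝ≥0∞)) :=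
      measurable_one.indicator (hG (j + 1)).compl
    have hanswer (p : M.State × Transcript U j) (q : BoolQuery U) :
        ∫⁻ r, (G (j + 1))ᶜ.indicator 1 (r.1, Fin.snoc p.2 (q, r.2)) ∂(M.answer (p.1, q)) ≤
          (G j)ᶜ.indicator 1 p + b := by
      by_cases hp : p ∈ G j
      · refine le_add_of_le_right (le_trans (le_of_eq ?_) (hstep j p q hp))
        exact lintegral_indicator_one
          ((hG (j + 1)).compl.preimage (by fun_prop : Measurable fun r : M.State × ℝ =>
            (r.1, (Fin.snoc p.2 (q, r.2) : Transcript U (j + 1)))))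
      · rw [Set.indicator_of_mem (Set.mem_compl hp)]
        refine le_add_of_le_left ((lintegral_mono fun r => ?_).trans_eq lintegral_one |>.trans ?_)
        · exact Set.indicator_le_self' (fun _ _ => zero_le) _
        · simp
    rw [← lintegral_indicator_one (hG (j + 1)).compl, lintegral_run_succ _ _ _ hind]
    calc _ ≤ ∫⁻ p, ∫⁻ _, ((G j)ᶜ.indicator 1 p + b) ∂(A.next j p.2) ∂(run M A x j) :=
          lintegral_mono fun p => lintegral_mono fun q => hanswer p q
      _ = run M A x j (G j)ᶜ + b := by
          simp only [lintegral_const, measure_univ, mul_one]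
          rw [lintegral_add_right _ measurable_const, lintegral_indicator_one (hG j).compl,
            lintegral_const, measure_univ, mul_one]
      _ ≤ b₀ + j * b + b := by gcongr
      _ = b₀ + ↑(j + 1) * b := by push_cast; ring

end

theorem toOuterMeasure_bind_le {α β : Type*} {p : PMF α} {f : α → PMF β} {s : Set α} {t : Set β}
    {b : ℝ≥0∞} (hf : ∀ a ∉ s, (f a).toOuterMeasure t ≤ b) :
    (p.bind f).toOuterMeasure t ≤ p.toOuterMeasure s + b := by
  rw [PMF.toOuterMeasure_bind_apply, PMF.toOuterMeasure_apply, ← one_mul b, ← p.tsum_coe,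
    ← ENNReal.tsum_mul_right, ← ENNReal.tsum_add]
  refine ENNReal.tsum_le_tsum fun a => ?_
  by_cases ha : a ∈ s
  · rw [Set.indicator_of_mem ha]
    refine le_add_of_le_left (mul_le_of_le_one_right' ?_)
    exact ((f a).toOuterMeasure.mono (Set.subset_univ t)).trans_eq
      (((f a).toOuterMeasure_apply_eq_one_iff _).2 (Set.subset_univ _))
  · exact le_add_of_le_right (mul_le_mul_right (hf a ha) _)

namespace SparseMechanism

variable {U : Type u} {n : ℕ} {Pub : Type u} {Z : Type*} {M : SparseMechanism U n Pub Z}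
  {x : Dataset U n} {b b₁ b₂ : ℝ≥0∞}

theorem step_le_of_outcome_le {σ : Pub} {q : BoolQuery U} {r : ℕ} {s : Set (Option Z × ℕ)}
    {t : Set (Option Z)} (ht : (M.outcome x σ q r).toOuterMeasure t ≤ b₁)
    (hrefresh : ∀ o ∉ t, (M.refresh σ q r o).toOuterMeasure {r' | (o, r') ∈ s} ≤ b₂) :
    (M.step x σ q r).toOuterMeasure s ≤ b₁ + b₂ :=
  (toOuterMeasure_bind_le fun o ho => by
    rw [PMF.toOuterMeasure_map_apply]
    exact hrefresh o ho).trans (add_le_add_left ht b₂)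

variable [Finite U] [Countable Pub]

theorem init_apply (M : SparseMechanism U n Pub Z) (x : Dataset U n) (s : Set M.algorithm.State) :
    M.algorithm.init x s = (M.fresh M.start).toOuterMeasure {r | (x, M.start, r) ∈ s} :=
  letI : MeasurableSpace (Dataset U n × Pub × ℕ) := ⊤
  (PMF.toMeasure_apply_eq_toOuterMeasure _ _).trans (PMF.toOuterMeasure_map_apply _ _ _)

theorem answer_apply (M : SparseMechanism U n Pub Z) (x : Dataset U n) (σ : Pub) (q : BoolQuery U)
    (r : ℕ) (s : Set (M.algorithm.State × ℝ)) :
    M.algorithm.answer ((x, σ, r), q) s = (M.step x σ q r).toOuterMeasure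
      {p | ((x, M.move σ q p.1, p.2), M.reply σ q p.1) ∈ s} :=
  letI : MeasurableSpace (Dataset U n × Pub × ℕ) := ⊤
  (PMF.toMeasure_apply_eq_toOuterMeasure _ _).trans (PMF.toOuterMeasure_map_apply _ _ _)

variable {good : ∀ j, Pub → ℕ → Set (Transcript U j)}

theorem le_trans_of_good (hgood : ∀ j σ r, MeasurableSet (good j σ r))
    (hstart : (M.fresh M.start).toOuterMeasure {r | Fin.elim0 ∉ good 0 M.start r} ≤ b₁)
    (hstep : ∀ j σ r t q, t ∈ good j σ r → (M.step x σ q r).toOuterMeasure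
      {p | Fin.snoc t (q, M.reply σ q p.1) ∉ good (j + 1) (M.move σ q p.1) p.2} ≤ b)
    (A : AdaptiveAnalyst U) {m : ℕ} {s : Set (Transcript U m)} (hs : ∀ σ r, good m σ r ⊆ s) :
    1 - (b₁ + m * b) ≤ trans M.algorithm A m x s := by
  let G (j : ℕ) : Set (M.algorithm.State × Transcript U j) :=
    ⋃ i : Pub × ℕ, {(x, i)} ×ˢ good j i.1 i.2
  have hmem {j : ℕ} {p : M.algorithm.State × Transcript U j} :
      p ∈ G j ↔ p.1.1 = x ∧ p.2 ∈ good j p.1.2.1 p.1.2.2 := by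
    rcases p with ⟨⟨y, σ, r⟩, t⟩
    constructor
    · intro hp
      obtain ⟨⟨σ', r'⟩, hstate, ht⟩ := Set.mem_iUnion.1 hp
      cases (hstate : (y, σ, r) = (x, σ', r'))
      exact ⟨rfl, ht⟩
    · rintro ⟨rfl, ht⟩
      exact Set.mem_iUnion.2 ⟨(σ, r), rfl, ht⟩
  have hmeas (j : ℕ) : MeasurableSet (G j) :=
    MeasurableSet.iUnion fun i => MeasurableSet.prod MeasurableSpace.measurableSet_top (hgood j _ _)
  have hfail : run M.algorithm A x m (G m)ᶜ ≤ b₁ + m * b := by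
    refine run_compl_le hmeas ?_ ?_ A m
    · rw [M.init_apply]
      refine ((M.fresh M.start).toOuterMeasure.mono ?_).trans hstart
      exact fun r hr ht => hr (hmem.2 ⟨rfl, ht⟩)
    · rintro j ⟨⟨y, σ, r⟩, t⟩ q hp
      obtain ⟨rfl, ht⟩ := hmem.1 hp
      refine (M.answer_apply _ _ _ _ _).trans_le ?_
      refine ((M.step y σ q r).toOuterMeasure.mono ?_).trans (hstep j σ r t q ht)
      exact fun p hp ht' => hp (hmem.2 ⟨rfl, ht'⟩)
  calc 1 - (b₁ + m * b) ≤ 1 - run M.algorithm A x m (G m)ᶜ := by gcongr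
    _ = run M.algorithm A x m (G m) := by
        rw [← prob_compl_eq_one_sub (hmeas m).compl, compl_compl]
    _ ≤ run M.algorithm A x m (Prod.snd ⁻¹' s) :=
        measure_mono fun p hp => hs _ _ (hmem.1 hp).2
    _ ≤ trans M.algorithm A m x s := Measure.le_map_apply measurable_snd.aemeasurable s

end SparseMechanism

/-! ### Noise -/

/-- The geometric distribution with ratio `exp (-e)`. -/
def geometric (e : ℝ) (he : 0 < e) : PMF ℕ :=
  (geometricMeasure ⟨1 - Real.exp (-e), sub_nonneg.2 (Real.exp_le_one_iff.2 (by linarith)),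
    sub_le_self _ (Real.exp_pos _).le⟩).toPMF

theorem geometric_apply {e : ℝ} (he : 0 < e) (r : ℕ) :
    geometric e he r = ENNReal.ofReal (Real.exp (-(e * r)) * (1 - Real.exp (-e))) := by
  have hp : 0 < 1 - Real.exp (-e) := by simpa using he
  rw [geometric, Measure.toPMF_apply,
    geometricMeasure_singleton fun h => hp.ne' (congrArg Subtype.val h),
    sub_sub_cancel, ← Real.exp_nat_mul]
  ring_nf

theorem geometric_add {e : ℝ} (he : 0 < e) (r s : ℕ) :
    geometric e he (r + s) = ENNReal.ofReal (Real.exp (-(e * s))) * geometric e he r := by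
  rw [geometric_apply, geometric_apply, ← ENNReal.ofReal_mul (Real.exp_pos _).le, ← mul_assoc,
    ← Real.exp_add]
  congr 3
  push_cast
  ring

theorem geometric_tail_le {e : ℝ} (he : 0 < e) (c : ℝ) :
    (geometric e he).toOuterMeasure {r | c < r} ≤ ENNReal.ofReal (Real.exp (-(e * c))) := by
  rw [PMF.toOuterMeasure_apply]
  rw [← ENNReal.summable.sum_add_tsum_nat_add' (k := ⌈c⌉₊)]
  have hsmall : ∑ r ∈ Finset.range ⌈c⌉₊,
      ({r | c < r} : Set ℕ).indicator (geometric e he) r = 0 :=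
    Finset.sum_eq_zero fun r hr => Set.indicator_of_notMem (s := {r : ℕ | c < r})
      (not_lt.2 (Nat.lt_ceil.1 (Finset.mem_range.1 hr)).le) _
  rw [hsmall, zero_add]
  calc ∑' r, ({r | c < r} : Set ℕ).indicator (geometric e he) (r + ⌈c⌉₊)
      ≤ ∑' r, ENNReal.ofReal (Real.exp (-(e * ⌈c⌉₊))) * geometric e he r :=
        ENNReal.tsum_le_tsum fun r =>
          (Set.indicator_le_self' (fun _ _ => zero_le) _).trans_eq (geometric_add he r _)
    _ = ENNReal.ofReal (Real.exp (-(e * ⌈c⌉₊))) := by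
        rw [ENNReal.tsum_mul_left, PMF.tsum_coe, mul_one]
    _ ≤ ENNReal.ofReal (Real.exp (-(e * c))) := by
        gcongr
        exact Nat.le_ceil c

/-- The total weight of the noisy answers to a query with count `c`. -/
def noiseMass (n : ℕ) (e : ℝ) (c : ℕ) : ℝ :=
  ∑ z : Fin (n + 1), Real.exp (-(e * |((z : ℕ) : ℝ) - c|))

/-- The probability of the noisy answer `z` to a query with count `c`: a discrete Laplace
distribution conditioned on `{0, …, n}`. -/
def noise (n : ℕ) (e : ℝ) (c : ℕ) (z : Fin (n + 1)) : ℝ :=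
  Real.exp (-(e * |((z : ℕ) : ℝ) - c|)) / noiseMass n e c

theorem noiseMass_pos (n : ℕ) (e : ℝ) (c : ℕ) : 0 < noiseMass n e c :=
  Finset.sum_pos (fun _ _ => Real.exp_pos _) ⟨0, Finset.mem_univ _⟩

theorem noise_nonneg (n : ℕ) (e : ℝ) (c : ℕ) (z : Fin (n + 1)) : 0 ≤ noise n e c z :=
  div_nonneg (Real.exp_pos _).le (noiseMass_pos n e c).le

theorem sum_noise (n : ℕ) (e : ℝ) (c : ℕ) : ∑ z, noise n e c z = 1 := by
  simp only [noise]
  rw [← Finset.sum_div]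
  exact div_self (noiseMass_pos n e c).ne'

section

variable {n : ℕ} {e s : ℝ} (he : 0 ≤ e) {c c' : ℕ}

include he

theorem exp_neg_mul_abs_sub_le (h : |(c : ℝ) - c'| ≤ 1) (z : ℝ) :
    Real.exp (-(e * |z - c|)) ≤ Real.exp e * Real.exp (-(e * |z - c'|)) := by
  rw [← Real.exp_add, Real.exp_le_exp]
  nlinarith [abs_sub_le z c c']

theorem noise_le (h : |(c : ℝ) - c'| ≤ 1) (z : Fin (n + 1)) :
    noise n e c z ≤ Real.exp (2 * e) * noise n e c' z := by
  have hmass : noiseMass n e c' ≤ Real.exp e * noiseMass n e c := by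
    simp only [noiseMass, Finset.mul_sum]
    exact Finset.sum_le_sum fun z _ => exp_neg_mul_abs_sub_le he (by rwa [abs_sub_comm]) _
  rw [noise, noise, ← mul_div_assoc, div_le_div_iff₀ (noiseMass_pos n e c) (noiseMass_pos n e c')]
  calc Real.exp (-(e * |((z : ℕ) : ℝ) - c|)) * noiseMass n e c'
      ≤ Real.exp e * Real.exp (-(e * |((z : ℕ) : ℝ) - c'|)) * (Real.exp e * noiseMass n e c) := by
        gcongr
        · exact (noiseMass_pos n e c').le
        · exact exp_neg_mul_abs_sub_le he h _
    _ = Real.exp (2 * e) * Real.exp (-(e * |((z : ℕ) : ℝ) - c'|)) * noiseMass n e c := by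
        rw [two_mul, Real.exp_add]; ring

theorem sum_noise_le_of_injOn {T : Finset (Fin (n + 1))} {f : Fin (n + 1) → Fin (n + 1)}
    (hinj : Set.InjOn f T)
    (hf : ∀ z ∈ T, |((f z : ℕ) : ℝ) - c| + s ≤ |((z : ℕ) : ℝ) - c|) :
    ∑ z ∈ T, noise n e c z ≤ Real.exp (-(e * s)) := by
  have hshift (z : Fin (n + 1)) (hz : z ∈ T) :
      noise n e c z ≤ Real.exp (-(e * s)) * noise n e c (f z) := by
    rw [noise, noise, ← mul_div_assoc, ← Real.exp_add]
    gcongr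
    · exact (noiseMass_pos n e c).le
    · nlinarith [hf z hz]
  calc ∑ z ∈ T, noise n e c z
      ≤ Real.exp (-(e * s)) * ∑ w ∈ T.image f, noise n e c w := by
        rw [Finset.sum_image hinj, Finset.mul_sum]
        exact Finset.sum_le_sum hshift
    _ ≤ Real.exp (-(e * s)) * ∑ w, noise n e c w := by
        gcongr
        exacts [fun z _ _ => noise_nonneg n e c z, Finset.subset_univ _]
    _ = Real.exp (-(e * s)) := by rw [sum_noise, mul_one]

theorem sum_noise_upper_tail_le (hs : 0 ≤ s) :
    ∑ z : Fin (n + 1) with s < (z.val : ℝ) - c, noise n e c z ≤ Real.exp (-(e * s)) := by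
  have hfar {z : Fin (n + 1)} (hz : s < (z.val : ℝ) - c) : c + ⌈s⌉₊ ≤ z := by
    have hcz : c ≤ (z : ℕ) := by exact_mod_cast (by linarith : (c : ℝ) ≤ (z : ℕ))
    have := Nat.ceil_le.2 (hz.le.trans_eq (Nat.cast_sub hcz).symm)
    omega
  refine sum_noise_le_of_injOn he (f := fun z => ⟨z - ⌈s⌉₊, by omega⟩) (fun z hz w hw hzw => ?_)
    fun z hz => ?_
  · have hz' := hfar (Finset.mem_filter.1 hz).2
    have hw' := hfar (Finset.mem_filter.1 hw).2
    have := congrArg Fin.val hzw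
    ext
    simp only at this
    omega
  · have hz' := hfar (Finset.mem_filter.1 hz).2
    have hge : (c : ℝ) + ⌈s⌉₊ ≤ (z : ℕ) := by exact_mod_cast hz'
    rw [Nat.cast_sub (by omega), abs_of_nonneg (by linarith), abs_of_nonneg (by linarith)]
    linarith [Nat.le_ceil s]

theorem sum_noise_lower_tail_le (hs : 0 ≤ s) (hc : c ≤ n) :
    ∑ z : Fin (n + 1) with s < c - (z.val : ℝ), noise n e c z ≤ Real.exp (-(e * s)) := by
  have hfar {z : Fin (n + 1)} (hz : s < c - (z.val : ℝ)) : z + ⌈s⌉₊ ≤ c := by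
    have hzc : (z : ℕ) ≤ c := by exact_mod_cast (by linarith : ((z : ℕ) : ℝ) ≤ c)
    have := Nat.ceil_le.2 (hz.le.trans_eq (Nat.cast_sub hzc).symm)
    omega
  refine sum_noise_le_of_injOn he (f := fun z => ⟨min (z + ⌈s⌉₊) n, by omega⟩)
    (fun z hz w hw hzw => ?_) fun z hz => ?_
  · have hz' := hfar (Finset.mem_filter.1 hz).2
    have hw' := hfar (Finset.mem_filter.1 hw).2
    have := congrArg Fin.val hzw
    ext
    simp only at this
    omega
  · have hz' := hfar (Finset.mem_filter.1 hz).2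
    have hle : ((z : ℕ) : ℝ) + ⌈s⌉₊ ≤ c := by exact_mod_cast hz'
    simp only [min_eq_left (hz'.trans hc), Nat.cast_add]
    rw [abs_of_nonpos (by linarith),
      abs_of_nonpos (by linarith [Nat.cast_nonneg (α := ℝ) ⌈s⌉₊])]
    linarith [Nat.le_ceil s]

theorem sum_noise_tail_le (hs : 0 ≤ s) (hc : c ≤ n) :
    ∑ z : Fin (n + 1) with s < |(z.val : ℝ) - c|, noise n e c z ≤ 2 * Real.exp (-(e * s)) := by
  simp only [lt_abs, neg_sub, Finset.filter_or]
  refine (le_add_of_nonneg_right (Finset.sum_nonneg fun z _ => noise_nonneg n e c z)).trans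
    ((Finset.sum_union_inter ..).trans_le ?_)
  linarith [sum_noise_upper_tail_le (n := n) he (c := c) hs, sum_noise_lower_tail_le he hs hc]

end

/-! ### Counts and medians -/

section

variable {U : Type u} {n : ℕ}

/-- The number of data points on which a query holds. -/
def count (q : BoolQuery U) (x : Dataset U n) : ℕ := {i | q (x i)}.toFinset.card

theorem count_le (q : BoolQuery U) (x : Dataset U n) : count q x ≤ n :=
  (Finset.card_le_univ _).trans_eq (Fintype.card_fin n)

theorem cast_count (q : BoolQuery U) (x : Dataset U n) :
    (count q x : ℝ) = ∑ i, truth q (x i) := by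
  simp [count, truth]

theorem queryValue_eq_count_div (q : BoolQuery U) (x : Dataset U n) :
    queryValue q x = count q x / n := by
  rw [queryValue, cast_count]

theorem abs_truth_sub_le (q : BoolQuery U) (u v : U) : |truth q u - truth q v| ≤ 1 := by
  unfold truth
  split_ifs <;> simp

theorem Neighboring.abs_count_sub_le {x x' : Dataset U n} (h : Neighboring x x')
    (q : BoolQuery U) : |(count q x : ℝ) - count q x'| ≤ 1 := by
  obtain ⟨i, -, hi⟩ := h
  rw [cast_count, cast_count, ← Finset.sum_sub_distrib, Finset.sum_eq_single i]
  · exact abs_truth_sub_le q _ _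
  · intro j _ hj
    rw [hi j hj, sub_self]
  · simp

end

section

variable {α : Type*} {V : Finset α} {f : α → ℕ}

/-- The least median of the values of `f` on `V`. -/
def median (V : Finset α) (f : α → ℕ) : ℕ := sInf {p | V.card ≤ 2 * {y ∈ V | f y ≤ p}.card}

variable {b : ℕ} (hf : ∀ y, f y ≤ b)

include hf

theorem card_le_two_mul_card_le_bound : V.card ≤ 2 * {y ∈ V | f y ≤ b}.card := by
  rw [Finset.filter_true_of_mem fun y _ => hf y]
  omega

theorem median_le : median V f ≤ b := Nat.sInf_le (card_le_two_mul_card_le_bound hf)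

theorem card_le_two_mul_card_le_median : V.card ≤ 2 * {y ∈ V | f y ≤ median V f}.card :=
  Nat.sInf_mem (s := {p | V.card ≤ 2 * {y ∈ V | f y ≤ p}.card})
    ⟨b, card_le_two_mul_card_le_bound hf⟩

theorem two_mul_card_median_lt_le : 2 * {y ∈ V | median V f < f y}.card ≤ V.card := by
  have hcompl := Finset.card_filter_add_card_filter_not (s := V) (fun y => f y ≤ median V f)
  have hmedian := card_le_two_mul_card_le_median (V := V) hf
  simp only [not_le] at hcompl
  omega

omit hf in
theorem two_mul_card_lt_median_le : 2 * {y ∈ V | f y < median V f}.card ≤ V.card := by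
  rcases Nat.eq_zero_or_pos (median V f) with hzero | hpos
  · simp [hzero]
  · have hnot : median V f - 1 ∉ {p | V.card ≤ 2 * {y ∈ V | f y ≤ p}.card} :=
      Nat.notMem_of_lt_sInf (Nat.sub_lt hpos one_pos)
    simp only [Set.mem_ofPred_eq, not_le, Nat.le_sub_one_iff_lt hpos] at hnot
    exact hnot.le

theorem two_mul_card_near_le {z c : ℝ} (hz : c < |z - median V f|) :
    2 * {y ∈ V | |(f y : ℝ) - z| ≤ c}.card ≤ V.card := by
  rcases le_total (median V f : ℝ) z with h | h
  · rw [abs_of_nonneg (sub_nonneg.2 h)] at hz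
    refine le_trans ?_ (two_mul_card_median_lt_le hf)
    gcongr with y _
    exact fun hy => Nat.cast_lt.1 (by linarith [(abs_le.1 hy).1] : (median V f : ℝ) < f y)
  · rw [abs_of_nonpos (sub_nonpos.2 h)] at hz
    refine le_trans ?_ (two_mul_card_lt_median_le (f := f))
    gcongr with y _
    exact fun hy => Nat.cast_lt.1 (by linarith [(abs_le.1 hy).2] : (f y : ℝ) < median V f)

end

/-! ### The halving mechanism -/

/-- The parameters of the halving mechanism: the number `depth` of halvings of the dataset that
summarise it in stage `0`, the privacy level `scale k` of a round of stage `k`, and the number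
`width` of standard scales of noise that are tolerated. -/
structure Schedule where
  depth : ℕ
  scale : ℕ → ℝ
  scale_pos : ∀ k, 0 < scale k
  scale_anti : Antitone scale
  width : ℝ
  width_nonneg : 0 ≤ width

namespace Schedule

variable (P : Schedule)

/-- The amount of noise tolerated in stage `k`. -/
def tol (k : ℕ) : ℝ := P.width / P.scale k

theorem tol_nonneg (k : ℕ) : 0 ≤ P.tol k := div_nonneg P.width_nonneg (P.scale_pos k).le

theorem tol_mono : Monotone P.tol := fun _ _ h =>
  div_le_div_of_nonneg_left P.width_nonneg (P.scale_pos _) (P.scale_anti h)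

theorem scale_mul_tol (k : ℕ) : P.scale k * P.tol k = P.width :=
  mul_div_cancel₀ _ (P.scale_pos k).ne'

/-- The probability, in stage `k` and with counter `r`, of answering afresh when the prediction is
off by `v`. -/
def fireProb (k : ℕ) (v : ℝ) (r : ℕ) : ℝ := min 1 (Real.exp (P.scale k * (v - 4 * P.tol k - r)))

section

variable (k : ℕ) {v v' : ℝ} {r : ℕ}

theorem fireProb_nonneg : 0 ≤ P.fireProb k v r := le_min zero_le_one (Real.exp_pos _).le

theorem fireProb_le_one : P.fireProb k v r ≤ 1 := min_le_left _ _

theorem fireProb_eq_one (h : 4 * P.tol k + r ≤ v) : P.fireProb k v r = 1 :=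
  min_eq_left (Real.one_le_exp (mul_nonneg (P.scale_pos k).le (by linarith)))

theorem fireProb_le_exp_neg_width (h : v ≤ 3 * P.tol k) :
    P.fireProb k v r ≤ Real.exp (-P.width) := by
  refine (min_le_right _ _).trans (Real.exp_le_exp.2 ?_)
  rw [← P.scale_mul_tol k, ← mul_neg]
  exact mul_le_mul_of_nonneg_left (by linarith [Nat.cast_nonneg (α := ℝ) r]) (P.scale_pos k).le

theorem fireProb_succ_le (h : v' ≤ v + 1) : P.fireProb k v' (r + 1) ≤ P.fireProb k v r := by
  refine min_le_min_left 1 (Real.exp_le_exp.2 (mul_le_mul_of_nonneg_left ?_ (P.scale_pos k).le))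
  push_cast
  linarith

theorem fireProb_le_exp_mul_fireProb_succ (h : v ≤ v' + 1) :
    P.fireProb k v r ≤ Real.exp (2 * P.scale k) * P.fireProb k v' (r + 1) := by
  have hk := P.scale_pos k
  rw [fireProb, fireProb, mul_min_of_nonneg _ _ (Real.exp_pos _).le, ← Real.exp_add, mul_one]
  refine min_le_min (Real.one_le_exp (by positivity)) (Real.exp_le_exp.2 ?_)
  push_cast
  nlinarith

end

end Schedule

section

variable {U : Type u} (P : Schedule) (n : ℕ)

/-- The prediction, in stage `k`, of a count from a summary `y` of the dataset: a point of `y`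
stands for `2 ^ (depth - k)` points of the dataset. -/
def guess (k : ℕ) (q : BoolQuery U) (y : Multiset U) : ℕ :=
  min n (2 ^ (P.depth - k) * y.countP fun u => q u)

theorem guess_le (k : ℕ) (q : BoolQuery U) (y : Multiset U) : guess P n k q y ≤ n :=
  min_le_left _ _

/-- The public state of the halving mechanism: the stage, and the summaries still considered. -/
abbrev PubState (U : Type u) : Type u := ℕ × Finset (Multiset U)

/-- The prediction of a count by the majority of the summaries still considered. -/
def predict (σ : PubState U) (q : BoolQuery U) : ℕ := median σ.2 (guess P n σ.1 q)

theorem predict_le (σ : PubState U) (q : BoolQuery U) : predict P n σ q ≤ n :=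
  median_le (guess_le P n σ.1 q)

/-- The summaries compatible with a noisy answer. -/
def survivors (σ : PubState U) (q : BoolQuery U) (z : ℕ) : Finset (Multiset U) :=
  {y ∈ σ.2 | |(guess P n σ.1 q y : ℝ) - z| ≤ 2 * P.tol σ.1}

variable {n}

/-- The error of the prediction. -/
def gap (x : Dataset U n) (σ : PubState U) (q : BoolQuery U) : ℝ :=
  |(count q x : ℝ) - predict P n σ q|

theorem gap_le_gap_add_one {x x' : Dataset U n} (h : Neighboring x x') (σ : PubState U)
    (q : BoolQuery U) : gap P x σ q ≤ gap P x' σ q + 1 := by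
  have htri := abs_sub_le (count q x : ℝ) (count q x') (predict P n σ q)
  have hcount := h.abs_count_sub_le q
  unfold gap
  linarith

/-- The law of the outcome of a round: either the prediction stands, or it is replaced by a noisy
count. -/
def outcomeLaw (x : Dataset U n) (σ : PubState U) (q : BoolQuery U) (r : ℕ) :
    PMF (Option (Fin (n + 1))) :=
  PMF.ofFintype (fun o => o.elim (ENNReal.ofReal (1 - P.fireProb σ.1 (gap P x σ q) r))
      fun z => ENNReal.ofReal
        (P.fireProb σ.1 (gap P x σ q) r * noise n (P.scale σ.1) (count q x) z)) <| by
    have hfire := P.fireProb_nonneg σ.1 (v := gap P x σ q) (r := r)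
    rw [Fintype.sum_option, Option.elim_none]
    simp only [Option.elim_some]
    rw [← ENNReal.ofReal_sum_of_nonneg fun z _ => mul_nonneg hfire (noise_nonneg _ _ _ z),
      ← Finset.mul_sum, sum_noise, mul_one,
      ← ENNReal.ofReal_add (sub_nonneg.2 (P.fireProb_le_one _)) hfire, sub_add_cancel,
      ENNReal.ofReal_one]

end

section

variable (U : Type u) [Fintype U] [DecidableEq U]

/-- The multisets of at most `s` elements, as a finite set. -/
def smallMultisets (s : ℕ) : Finset (Multiset U) :=
  (Finset.univ : Finset (List.Vector (Option U) s)).image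
    fun v => (v.1 : Multiset (Option U)).filterMap id

variable {U}

theorem mem_smallMultisets {s : ℕ} {y : Multiset U} (hy : y.card ≤ s) :
    y ∈ smallMultisets U s := by
  induction y using Quotient.inductionOn with
  | h l =>
    have hl : l.length ≤ s := hy
    refine Finset.mem_image.2 ⟨⟨l.map some ++ List.replicate (s - l.length) none, ?_⟩,
      Finset.mem_univ _, ?_⟩
    · simp only [List.length_append, List.length_map, List.length_replicate]
      omega
    · simp [List.filterMap_append]

variable (U)

theorem card_smallMultisets_le (s : ℕ) :
    (smallMultisets U s).card ≤ (Fintype.card U + 1) ^ s := by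
  refine Finset.card_image_le.trans ?_
  rw [Finset.card_univ, card_vector, Fintype.card_option]

/-- The summaries considered in stage `k`. -/
def candidates (k : ℕ) : Finset (Multiset U) := smallMultisets U (2 ^ (k + 1))

end

section

variable (P : Schedule) (U : Type u) [Fintype U] [DecidableEq U] (n : ℕ)

open Classical in
/-- The halving mechanism: it predicts with the median of the summaries still considered, and when
the prediction is noticeably wrong it publishes a noisy count and drops the summaries that are not
compatible with it. A stage ends when no summary is left. The second case of `next` also covers the
event that fewer than half of the summaries are dropped, so that privacy never depends on the size
of the noise. -/
def halving : SparseMechanism U n (PubState U) (Fin (n + 1)) where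
  start := (0, candidates U 0)
  fresh σ := geometric (P.scale σ.1) (P.scale_pos σ.1)
  outcome := outcomeLaw P
  next σ q z :=
    if (survivors P n σ q z).Nonempty ∧ 2 * (survivors P n σ q z).card ≤ σ.2.card then
      (σ.1, survivors P n σ q z)
    else (σ.1 + 1, candidates U (σ.1 + 1))
  reply σ q o := (o.elim (predict P n σ q) (fun z => (z : ℕ)) : ℕ) / n

variable {P U n}

theorem halving_outcome_none (x : Dataset U n) (σ : PubState U) (q : BoolQuery U) (r : ℕ) :
    (halving P U n).outcome x σ q r none =
      ENNReal.ofReal (1 - P.fireProb σ.1 (gap P x σ q) r) := rfl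

theorem halving_outcome_some (x : Dataset U n) (σ : PubState U) (q : BoolQuery U) (r : ℕ)
    (z : Fin (n + 1)) : (halving P U n).outcome x σ q r (some z) = ENNReal.ofReal
      (P.fireProb σ.1 (gap P x σ q) r * noise n (P.scale σ.1) (count q x) z) := rfl

theorem halving_dominated {x x' : Dataset U n} (hx : Neighboring x x') :
    (halving P U n).Dominated (fun σ => P.scale σ.1) x x' where
  fresh σ r := by
    change geometric _ (P.scale_pos σ.1) r ≤ _ * geometric _ (P.scale_pos σ.1) (r + 1)
    rw [geometric_add, ← mul_assoc, ← ENNReal.ofReal_mul (Real.exp_pos _).le, ← Real.exp_add]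
    simp
  stay σ q r := ENNReal.ofReal_le_ofReal <| sub_le_sub_left
    (P.fireProb_succ_le σ.1 (gap_le_gap_add_one P hx.symm σ q)) 1
  change σ q r z := by
    rw [halving_outcome_some, halving_outcome_some, ← ENNReal.ofReal_mul (Real.exp_pos _).le]
    apply ENNReal.ofReal_le_ofReal
    calc P.fireProb σ.1 (gap P x σ q) r * noise n (P.scale σ.1) (count q x) z
        ≤ (Real.exp (2 * P.scale σ.1) * P.fireProb σ.1 (gap P x' σ q) (r + 1)) *
            (Real.exp (2 * P.scale σ.1) * noise n (P.scale σ.1) (count q x') z) :=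
          mul_le_mul (P.fireProb_le_exp_mul_fireProb_succ σ.1 (gap_le_gap_add_one P hx σ q))
            (noise_le (P.scale_pos σ.1).le (hx.abs_count_sub_le q) z) (noise_nonneg _ _ _ _)
            (mul_nonneg (Real.exp_pos _).le (P.fireProb_nonneg _))
      _ = Real.exp (4 * P.scale σ.1) * (P.fireProb σ.1 (gap P x' σ q) (r + 1) *
            noise n (P.scale σ.1) (count q x') z) := by
          rw [show 4 * P.scale σ.1 = 2 * P.scale σ.1 + 2 * P.scale σ.1 by ring, Real.exp_add]
          ring

/-- The privacy budget of the halving mechanism: `a / (k + 2)` is set aside for the stages after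
stage `k`, and stage `k` still needs one unit for each halving of the set of summaries. -/
def budget (P : Schedule) (l : ℕ) (a : ℝ) (σ : PubState U) : ℝ :=
  a / (σ.1 + 2) + momentCost l (5 * P.scale σ.1) * (Nat.log 2 σ.2.card + 1)

variable {l : ℕ} {a : ℝ}

theorem budget_candidates_le {k : ℕ}
    (ha : momentCost l (5 * P.scale k) * (Nat.log 2 (candidates U k).card + 1) ≤
      a / ((k + 1) * (k + 2))) : budget P l a (k, candidates U k) ≤ a / (k + 1) := by
  have hsplit : a / ((k : ℝ) + 1) = a / (k + 2) + a / ((k + 1) * (k + 2)) := by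
    field_simp
    ring
  rw [hsplit]
  exact add_le_add_right ha _

variable (ha : ∀ k, momentCost l (5 * P.scale k) * (Nat.log 2 (candidates U k).card + 1) ≤
  a / ((k + 1) * (k + 2)))

include ha

theorem budget_next_add_le (σ : PubState U) (q : BoolQuery U) (z : Fin (n + 1)) :
    budget P l a ((halving P U n).next σ q z) + momentCost l (5 * P.scale σ.1) ≤
      budget P l a σ := by
  have hcost := momentCost_nonneg l (5 * P.scale σ.1)
  simp only [halving]
  split_ifs with h
  · have hlog : Nat.log 2 (survivors P n σ q z).card + 1 ≤ Nat.log 2 σ.2.card := by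
      rw [← Nat.log_mul_base one_lt_two (Finset.card_pos.2 h.1).ne', mul_comm]
      exact Nat.log_mono_right h.2
    have hlog' : (Nat.log 2 (survivors P n σ q z).card : ℝ) + 1 ≤ Nat.log 2 σ.2.card := by
      exact_mod_cast hlog
    simp only [budget]
    nlinarith
  · have hnext := budget_candidates_le (ha (σ.1 + 1))
    have hlog : momentCost l (5 * P.scale σ.1) ≤
        momentCost l (5 * P.scale σ.1) * (Nat.log 2 σ.2.card + 1) :=
      le_mul_of_one_le_right hcost (le_add_of_nonneg_left (Nat.cast_nonneg _))
    rw [Nat.cast_succ, add_assoc, one_add_one_eq_two] at hnext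
    exact add_le_add hnext hlog

theorem halving_budget : (halving P U n).Budget (fun σ => P.scale σ.1) l (budget P l a) where
  pos σ := P.scale_pos σ.1
  le σ := by
    have hcost := momentCost_nonneg l (5 * P.scale σ.1)
    have hrest : 0 ≤ a / ((σ.1 : ℝ) + 2) := by
      have := (mul_nonneg (momentCost_nonneg l (5 * P.scale 0)) (by positivity)).trans (ha 0)
      norm_num at this
      exact div_nonneg (by linarith) (by positivity)
    exact (le_mul_of_one_le_right hcost (le_add_of_nonneg_left (Nat.cast_nonneg _))).trans
      (le_add_of_nonneg_left hrest)
  next := budget_next_add_le ha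

end

/-! ### Accuracy of the halving mechanism -/

section

variable {U : Type u} {n : ℕ}

/-- The summary `y` predicts, in stage `k`, all queries of the transcript within the tolerance. -/
def Accurate (P : Schedule) (x : Dataset U n) (k : ℕ) (y : Multiset U) {j : ℕ}
    (t : Transcript U j) : Prop :=
  ∀ i, |(guess P n k (t i).1 y : ℝ) - count (t i).1 x| ≤ P.tol k

variable {P : Schedule} {x : Dataset U n} {k : ℕ} {y : Multiset U} {j : ℕ} {t : Transcript U j}

theorem accurate_snoc {p : BoolQuery U × ℝ} :
    Accurate P x k y (Fin.snoc t p : Transcript U (j + 1)) ↔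
      Accurate P x k y t ∧ |(guess P n k p.1 y : ℝ) - count p.1 x| ≤ P.tol k := by
  simp only [Accurate, Fin.forall_fin_succ', Fin.snoc_castSucc, Fin.snoc_last]

theorem abs_queryValue_sub_div_le_one (q : BoolQuery U) {c : ℕ} (hc : c ≤ n) :
    |queryValue q x - (c : ℝ) / n| ≤ 1 := by
  rw [queryValue_eq_count_div, ← sub_div, abs_div, Nat.abs_cast]
  refine div_le_one_of_le₀ (abs_sub_le_of_nonneg_of_le (by positivity) ?_ (by positivity) ?_)
    (Nat.cast_nonneg n)
  · exact_mod_cast count_le q x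
  · exact_mod_cast hc

variable {σ : PubState U} {q : BoolQuery U} {r : ℕ}

theorem two_mul_card_survivors_le {z : Fin (n + 1)} (hgap : 3 * P.tol σ.1 < gap P x σ q)
    (hz : |(z.val : ℝ) - count q x| ≤ P.tol σ.1) :
    2 * (survivors P n σ q z).card ≤ σ.2.card := by
  refine two_mul_card_near_le (guess_le P n σ.1 q) ?_
  have htri := abs_sub_le (count q x : ℝ) z (predict P n σ q)
  rw [abs_sub_comm (count q x : ℝ) z] at htri
  rw [gap] at hgap
  change 2 * P.tol σ.1 < |(z.val : ℝ) - predict P n σ q|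
  linarith

theorem measurable_accurate [Finite U] :
    Measurable fun t : Transcript U j => Accurate P x k y t :=
  .forall fun i => (Measurable.of_discrete (f := fun q : BoolQuery U =>
    |(guess P n k q y : ℝ) - count q x| ≤ P.tol k)).comp <|
      measurable_fst.comp (measurable_pi_apply i)

variable [Fintype U] [DecidableEq U]

/-- A transcript of stage `k`: the answers are within the tolerance, and every summary of an earlier
stage has been refuted. -/
structure Sound (P : Schedule) (x : Dataset U n) (k : ℕ) {j : ℕ} (t : Transcript U j) : Prop where
  near : ∀ i, |queryValue (t i).1 x - (t i).2| ≤ min (5 * P.tol k / n) 1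
  earlier : ∀ l < k, ∀ y ∈ candidates U l, ¬ Accurate P x l y t

theorem Sound.snoc (h : Sound P x k t) {q : BoolQuery U} {c : ℕ} (hc : c ≤ n)
    (hq : |(count q x : ℝ) - c| ≤ 5 * P.tol k) :
    Sound P x k (Fin.snoc t (q, (c : ℝ) / n) : Transcript U (j + 1)) where
  near := by
    simp only [Fin.forall_fin_succ', Fin.snoc_castSucc, Fin.snoc_last]
    refine ⟨h.near, le_min ?_ (abs_queryValue_sub_div_le_one q hc)⟩
    rw [queryValue_eq_count_div, ← sub_div, abs_div, Nat.abs_cast]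
    gcongr
  earlier l hl y hy hacc := h.earlier l hl y hy (accurate_snoc.1 hacc).1

theorem Sound.succ (h : Sound P x k t) (hk : ∀ y ∈ candidates U k, ¬ Accurate P x k y t) :
    Sound P x (k + 1) t where
  near i := (h.near i).trans (min_le_min_right _ (by gcongr; exact P.tol_mono k.le_succ))
  earlier l hl := (Nat.lt_succ_iff_lt_or_eq.1 hl).elim (h.earlier l) fun h => h ▸ hk

/-- The invariant of the halving mechanism while no noise is excessive. -/
structure Invariant (P : Schedule) (x : Dataset U n) (σ : PubState U) (r : ℕ) {j : ℕ}
    (t : Transcript U j) : Prop where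
  small : (r : ℝ) ≤ P.tol σ.1
  sound : Sound P x σ.1 t
  mem : ∀ y ∈ candidates U σ.1, Accurate P x σ.1 y t → y ∈ σ.2

theorem measurableSet_invariant (σ : PubState U) (r : ℕ) :
    MeasurableSet {t : Transcript U j | Invariant P x σ r t} := by
  have hset : {t : Transcript U j | Invariant P x σ r t} = {t | (r : ℝ) ≤ P.tol σ.1 ∧
      ((∀ i, |queryValue (t i).1 x - (t i).2| ≤ min (5 * P.tol σ.1 / n) 1) ∧
        ∀ l < σ.1, ∀ y ∈ candidates U l, ¬ Accurate P x l y t) ∧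
      ∀ y ∈ candidates U σ.1, Accurate P x σ.1 y t → y ∈ σ.2} :=
    Set.ext fun t => ⟨fun ⟨hr, ⟨hnear, hearlier⟩, hmem⟩ => ⟨hr, ⟨hnear, hearlier⟩, hmem⟩,
      fun ⟨hr, ⟨hnear, hearlier⟩, hmem⟩ => ⟨hr, ⟨hnear, hearlier⟩, hmem⟩⟩
  have haccurate (k : ℕ) (y : Multiset U) :
      Measurable fun t : Transcript U j => Accurate P x k y t := measurable_accurate
  have _ (i : Fin j) : Measurable fun t : Transcript U j =>
      |queryValue (t i).1 x - (t i).2| ≤ min (5 * P.tol σ.1 / n) 1 := by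
    have hvalue : Measurable fun q : BoolQuery U => queryValue q x := .of_discrete
    exact measurableSet_setOfPred.1 (measurableSet_le (by fun_prop) measurable_const)
  rw [hset]
  apply measurableSet_setOfPred.2
  fun_prop

/-- The outcome of a round is good if the answer is within the tolerance, and a noisy count is
published only when it drops half of the summaries. -/
def GoodOutcome (P : Schedule) (x : Dataset U n) (σ : PubState U) (q : BoolQuery U) :
    Option (Fin (n + 1)) → Prop
  | none => gap P x σ q ≤ 5 * P.tol σ.1
  | some z => 3 * P.tol σ.1 < gap P x σ q ∧ |(z.val : ℝ) - count q x| ≤ P.tol σ.1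

theorem halving_outcome_none_eq_zero (hr : (r : ℝ) ≤ P.tol σ.1)
    (hgap : 5 * P.tol σ.1 < gap P x σ q) : (halving P U n).outcome x σ q r none = 0 := by
  rw [halving_outcome_none, P.fireProb_eq_one σ.1 (by linarith), sub_self, ENNReal.ofReal_zero]

theorem sum_halving_outcome_some (s : Finset (Fin (n + 1))) :
    ∑ z ∈ s, (halving P U n).outcome x σ q r (some z) = ENNReal.ofReal
      (P.fireProb σ.1 (gap P x σ q) r * ∑ z ∈ s, noise n (P.scale σ.1) (count q x) z) := by
  rw [Finset.mul_sum, ENNReal.ofReal_sum_of_nonneg fun z _ =>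
    mul_nonneg (P.fireProb_nonneg σ.1) (noise_nonneg _ _ _ z)]
  rfl

theorem sum_halving_outcome_some_le_of_gap_le (hgap : gap P x σ q ≤ 3 * P.tol σ.1) :
    ∑ z, (halving P U n).outcome x σ q r (some z) ≤ ENNReal.ofReal (Real.exp (-P.width)) := by
  rw [sum_halving_outcome_some, sum_noise, mul_one]
  exact ENNReal.ofReal_le_ofReal (P.fireProb_le_exp_neg_width σ.1 hgap)

theorem sum_halving_outcome_far_le :
    ∑ z : Fin (n + 1) with P.tol σ.1 < |(z.val : ℝ) - count q x|,
      (halving P U n).outcome x σ q r (some z) ≤ ENNReal.ofReal (2 * Real.exp (-P.width)) := by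
  rw [sum_halving_outcome_some, ← P.scale_mul_tol σ.1]
  exact ENNReal.ofReal_le_ofReal <| (mul_le_of_le_one_left
    (Finset.sum_nonneg fun z _ => noise_nonneg _ _ _ z) (P.fireProb_le_one σ.1)).trans
    (sum_noise_tail_le (P.scale_pos _).le (P.tol_nonneg _) (count_le q x))

theorem toOuterMeasure_not_goodOutcome_le (hr : (r : ℝ) ≤ P.tol σ.1) :
    ((halving P U n).outcome x σ q r).toOuterMeasure {o | ¬ GoodOutcome P x σ q o} ≤
      ENNReal.ofReal (2 * Real.exp (-P.width)) := by
  classical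
  have hnone : {o | ¬ GoodOutcome P x σ q o}.indicator ((halving P U n).outcome x σ q r) none
      = 0 := by
    refine Set.indicator_apply_eq_zero.2 fun hbad => ?_
    exact halving_outcome_none_eq_zero hr (not_le.1 hbad)
  rw [PMF.toOuterMeasure_apply_fintype, Fintype.sum_option, hnone, zero_add]
  rcases le_or_gt (gap P x σ q) (3 * P.tol σ.1) with hgap | hgap
  · calc _ ≤ ∑ z, (halving P U n).outcome x σ q r (some z) :=
          Finset.sum_le_sum fun z _ => Set.indicator_le_self _ _ _
      _ ≤ ENNReal.ofReal (Real.exp (-P.width)) := sum_halving_outcome_some_le_of_gap_le hgap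
      _ ≤ ENNReal.ofReal (2 * Real.exp (-P.width)) :=
          ENNReal.ofReal_le_ofReal (by linarith [Real.exp_pos (-P.width)])
  · refine le_trans (le_of_eq ?_) (sum_halving_outcome_far_le (x := x) (q := q) (σ := σ) (r := r))
    rw [Finset.sum_filter]
    refine Finset.sum_congr rfl fun z _ => ?_
    simp only [Set.indicator_apply, Set.mem_ofPred_eq, GoodOutcome, hgap, true_and, not_le]

theorem Invariant.mem_survivors (hI : Invariant P x σ r t) {z : Fin (n + 1)}
    (hz : |(z.val : ℝ) - count q x| ≤ P.tol σ.1) {a : ℝ} {y : Multiset U}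
    (hy : y ∈ candidates U σ.1)
    (hacc : Accurate P x σ.1 y (Fin.snoc t (q, a) : Transcript U (j + 1))) :
    y ∈ survivors P n σ q z := by
  rw [accurate_snoc] at hacc
  refine Finset.mem_filter.2 ⟨hI.mem y hy hacc.1, ?_⟩
  have htri := abs_sub_le (guess P n σ.1 q y : ℝ) (count q x) z
  rw [abs_sub_comm (count q x : ℝ)] at htri
  linarith [hacc.2]

theorem Invariant.move_some (hI : Invariant P x σ r t) {z : Fin (n + 1)}
    (hgap : 3 * P.tol σ.1 < gap P x σ q) (hz : |(z.val : ℝ) - count q x| ≤ P.tol σ.1) {r' : ℕ}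
    (hr' : (r' : ℝ) ≤ P.tol ((halving P U n).next σ q z).1) :
    Invariant P x ((halving P U n).next σ q z) r'
      (Fin.snoc t (q, (z.val : ℝ) / n) : Transcript U (j + 1)) := by
  have hsound := hI.sound.snoc z.is_le (q := q)
    (by rw [abs_sub_comm]; linarith [P.tol_nonneg σ.1])
  simp only [halving, two_mul_card_survivors_le hgap hz, and_true] at hr' ⊢
  split_ifs at hr' ⊢ with hne
  · exact ⟨hr', hsound, fun y hy hacc => hI.mem_survivors hz hy hacc⟩
  · exact ⟨hr', hsound.succ fun y hy hacc => hne ⟨y, hI.mem_survivors hz hy hacc⟩,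
      fun y hy _ => hy⟩

theorem Invariant.move (hI : Invariant P x σ r t) {o : Option (Fin (n + 1))}
    (ho : GoodOutcome P x σ q o) {r' : ℕ}
    (hr' : (r' : ℝ) ≤ P.tol ((halving P U n).move σ q o).1) :
    Invariant P x ((halving P U n).move σ q o) r'
      (Fin.snoc t (q, (halving P U n).reply σ q o) : Transcript U (j + 1)) := by
  rcases o with _ | z
  · exact ⟨hr', hI.sound.snoc (predict_le P n σ q) ho, fun y hy hacc =>
      hI.mem y hy (accurate_snoc.1 hacc).1⟩
  · exact hI.move_some ho.1 ho.2 hr'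

theorem halving_refresh_tail_le (hr : (r : ℝ) ≤ P.tol σ.1) (o : Option (Fin (n + 1))) :
    ((halving P U n).refresh σ q r o).toOuterMeasure
      {r' | P.tol ((halving P U n).move σ q o).1 < r'} ≤ ENNReal.ofReal (Real.exp (-P.width)) := by
  rcases o with _ | z
  · exact ((PMF.toOuterMeasure_pure_apply r _).trans (if_neg hr.not_gt)).trans_le zero_le
  · exact P.scale_mul_tol ((halving P U n).next σ q z).1 ▸ geometric_tail_le (P.scale_pos _) _

theorem Invariant.step_le (hI : Invariant P x σ r t) (q : BoolQuery U) :
    ((halving P U n).step x σ q r).toOuterMeasure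
      {p | Fin.snoc t (q, (halving P U n).reply σ q p.1) ∉
        {t : Transcript U (j + 1) | Invariant P x ((halving P U n).move σ q p.1) p.2 t}} ≤
      ENNReal.ofReal (3 * Real.exp (-P.width)) := by
  refine (SparseMechanism.step_le_of_outcome_le (toOuterMeasure_not_goodOutcome_le hI.small)
    (b₂ := ENNReal.ofReal (Real.exp (-P.width))) fun o ho => ?_).trans_eq ?_
  · refine (OuterMeasure.mono _ fun r' hr' => ?_).trans (halving_refresh_tail_le hI.small o)
    exact lt_of_not_ge fun h => hr' (hI.move (not_not.1 ho) h)
  · rw [← ENNReal.ofReal_add (by positivity) (by positivity)]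
    ring_nf

theorem halving_start_le (P : Schedule) (x : Dataset U n) :
    ((halving P U n).fresh (halving P U n).start).toOuterMeasure
      {r | (Fin.elim0 : Transcript U 0) ∉ {t | Invariant P x (halving P U n).start r t}} ≤
      ENNReal.ofReal (Real.exp (-P.width)) := by
  refine (OuterMeasure.mono _ fun r hr => ?_).trans
    (P.scale_mul_tol 0 ▸ geometric_tail_le (P.scale_pos 0) (P.tol 0))
  exact lt_of_not_ge fun hle => hr
    ⟨hle, ⟨fun i => i.elim0, fun l hl => absurd hl l.not_lt_zero⟩, fun y hy _ => hy⟩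

theorem halving_accurate (P : Schedule) (A : AdaptiveAnalyst U) (x : Dataset U n) {m : ℕ}
    {s : Set (Transcript U m)} (hs : ∀ k t, Sound P x k t → t ∈ s) :
    ENNReal.ofReal (1 - (3 * m + 1) * Real.exp (-P.width)) ≤
      trans (halving P U n).algorithm A m x s := by
  refine le_trans (le_of_eq ?_) (SparseMechanism.le_trans_of_good
    (good := fun j σ r => {t | Invariant P x σ r t}) (fun j => measurableSet_invariant)
    (halving_start_le P x) (fun j σ r t q hI => hI.step_le q) A
    fun σ r t hI => hs σ.1 t hI.sound)
  rw [← ENNReal.ofReal_natCast m, ← ENNReal.ofReal_mul m.cast_nonneg,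
    ← ENNReal.ofReal_add (by positivity) (by positivity), ← ENNReal.ofReal_one,
    ← ENNReal.ofReal_sub _ (by positivity)]
  ring_nf

end

/-! ### Colourings -/

section

variable {U : Type u} {n : ℕ}

/-- A colouring of the columns in `S` with the colours `1` and `-1`, extended by zero to the other
columns so that its discrepancy is a sum over all of `U`. -/
structure IsColoring (S : Finset U) (χ : U → ℤ) : Prop where
  sign : ∀ u ∈ S, χ u = 1 ∨ χ u = -1
  zero : ∀ u ∉ S, χ u = 0

theorem exists_coloring [Fintype U] {k : ℕ} (B : Matrix (Fin k) U ℝ) {w : ℕ} {S : Finset U}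
    (hS : S.card ≤ w) :
    ∃ χ : U → ℤ, IsColoring S χ ∧ ∀ i, |∑ u, B i u * χ u| ≤ hdisc B w := by
  classical
  let height (S : Finset U) (z : S → ℤˣ) : ℝ :=
    ‖(B.submatrix id (Subtype.val : S → U)).mulVec fun v => (((z v : ℤˣ) : ℤ) : ℝ)‖
  obtain ⟨z, hz⟩ := exists_eq_ciInf_of_finite (f := height S)
  have hle : height S z ≤ hdisc B w :=
    hz.trans_le <| le_ciSup (f := fun S : {S : Finset U // S.card ≤ w} => ⨅ z, height S.1 z)
      (Set.finite_range _).bddAbove ⟨S, hS⟩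
  refine ⟨fun u => if h : u ∈ S then ((z ⟨u, h⟩ : ℤˣ) : ℤ) else 0, ⟨fun u hu => ?_,
    fun u hu => dif_neg hu⟩, fun i => le_trans (le_of_eq ?_) ((norm_le_pi_norm _ i).trans hle)⟩
  · simp only [dif_pos hu]
    exact (Int.units_eq_one_or (z ⟨u, hu⟩)).imp (by simp [·]) (by simp [·])
  · rw [Real.norm_eq_abs, ← Finset.sum_subset (Finset.subset_univ S) (fun u _ hu => by simp [hu]),
      ← Finset.sum_coe_sort S]
    simp [Matrix.mulVec, dotProduct]

theorem appendOnes_last {k : ℕ} (B : Matrix (Fin k) U ℝ) :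
    appendOnes B (Fin.last k) = fun _ => 1 :=
  Fin.snoc_last (α := fun _ => U → ℝ) _ _

theorem appendOnes_castSucc {m : ℕ} (Q : Fin m → BoolQuery U) (j : Fin m) :
    appendOnes (queryMatrix Q) j.castSucc = truth (Q j) :=
  Fin.snoc_castSucc (α := fun _ => U → ℝ) _ _ _

theorem one_le_hdiscStar [Finite U] [Nonempty U] {m : ℕ} (Q : Fin m → BoolQuery U) (hn : 1 ≤ n) :
    1 ≤ hdiscStar Q n := by
  have := Fintype.ofFinite U
  obtain ⟨u⟩ := ‹Nonempty U›
  obtain ⟨χ, hS, hχ⟩ := exists_coloring (appendOnes (queryMatrix Q)) (w := n) (S := {u})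
    (by simpa using hn)
  have hlast := hχ (Fin.last m)
  rw [Finset.sum_eq_single u (fun v _ hv => by simp [hS.zero v (by simpa using hv)]) (by simp)]
    at hlast
  refine le_trans (le_of_eq ?_) hlast
  rcases hS.sign u (by simp) with h | h <;> simp [appendOnes_last, h]

/-! ### Small summaries of a dataset -/

theorem sum_map_eq_sum_count [Fintype U] [DecidableEq U] (f : U → ℝ) (y : Multiset U) :
    (y.map f).sum = ∑ u, f u * y.count u := by
  rw [Finset.sum_multiset_map_count]
  refine (Finset.sum_subset (Finset.subset_univ _) fun u _ hu => ?_).trans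
    (Finset.sum_congr rfl fun u _ => by rw [nsmul_eq_mul, mul_comm])
  rw [Multiset.count_eq_zero_of_notMem (by simpa using hu), zero_smul]

theorem sum_map_truth (q : BoolQuery U) (y : Multiset U) :
    (y.map (truth q)).sum = (y.countP fun u => q u : ℕ) := by
  induction y using Multiset.induction with
  | empty => simp
  | cons u y ih => by_cases hu : q u <;> simp [ih, hu, truth, add_comm]

theorem exists_count_eq [Finite U] [DecidableEq U] (a : U → ℕ) :
    ∃ y : Multiset U, ∀ u, y.count u = a u := by
  have := Fintype.ofFinite U
  exact ⟨∑ u, Multiset.replicate (a u) u, fun u => by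
    simp [Multiset.count_sum', Multiset.count_replicate]⟩

theorem exists_two_mul_eq_add {a : ℕ} {e : ℤ} (hodd : Odd a → e = 1 ∨ e = -1)
    (heven : ¬ Odd a → e = 0) : ∃ c : ℕ, 2 * (c : ℤ) = a + e ∧ c ≤ a := by
  rcases Nat.even_or_odd' a with ⟨c, rfl | rfl⟩
  · exact ⟨c, by simp [heven (by simp)], by lia⟩
  · rcases hodd (by simp) with rfl | rfl
    · exact ⟨c + 1, by push_cast; ring, by lia⟩
    · exact ⟨c, by push_cast; ring, by lia⟩

/-- Only the elements of odd multiplicity have to be rounded, and a colouring of small discrepancy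
says in which direction. -/
theorem exists_half [Finite U] {k : ℕ} (B : Matrix (Fin k) U ℝ) {w : ℕ} {y : Multiset U}
    (hy : y.card ≤ w) :
    ∃ y' : Multiset U, y'.card ≤ w ∧
      ∀ i, |2 * (y'.map (B i)).sum - (y.map (B i)).sum| ≤ hdisc B w := by
  classical
  have := Fintype.ofFinite U
  obtain ⟨χ, hS, hχ⟩ := exists_coloring B (w := w) (S := {u | Odd (y.count u)}) <| by
    refine le_trans (Finset.card_le_card fun u hu => ?_) (y.toFinset_card_le.trans hy)
    exact Multiset.mem_toFinset.2 (Multiset.count_pos.1 (Finset.mem_filter.1 hu).2.pos)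
  choose a ha hay using fun u => exists_two_mul_eq_add (a := y.count u) (e := χ u)
    (fun hu => hS.sign u (by simpa using hu)) (fun hu => hS.zero u (by simpa using hu))
  obtain ⟨y', hy'⟩ := exists_count_eq a
  refine ⟨y', (Multiset.card_le_card ?_).trans hy, fun i => le_trans (le_of_eq ?_) (hχ i)⟩
  · exact Multiset.le_iff_count.2 fun u => (hy' u).trans_le (hay u)
  · congr 1
    rw [sum_map_eq_sum_count, sum_map_eq_sum_count, Finset.mul_sum, ← Finset.sum_sub_distrib]
    refine Finset.sum_congr rfl fun u _ => ?_
    have hu : (2 : ℝ) * a u = y.count u + χ u := by exact_mod_cast ha u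
    rw [hy']
    linear_combination B i u * hu

theorem exists_iterated_half [Finite U] {k : ℕ} (B : Matrix (Fin k) U ℝ) {w : ℕ} {y : Multiset U}
    (hy : y.card ≤ w) (d : ℕ) :
    ∃ y' : Multiset U, y'.card ≤ w ∧
      ∀ i, |2 ^ d * (y'.map (B i)).sum - (y.map (B i)).sum| ≤ (2 ^ d - 1) * hdisc B w := by
  induction d with
  | zero => exact ⟨y, hy, fun i => by simp⟩
  | succ d ih =>
    obtain ⟨y₁, hy₁, hd⟩ := ih
    obtain ⟨y₂, hy₂, hhalf⟩ := exists_half B hy₁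
    refine ⟨y₂, hy₂, fun i => ?_⟩
    calc |2 ^ (d + 1) * (y₂.map (B i)).sum - (y.map (B i)).sum|
        = |2 ^ d * (2 * (y₂.map (B i)).sum - (y₁.map (B i)).sum) +
            (2 ^ d * (y₁.map (B i)).sum - (y.map (B i)).sum)| := by ring_nf
      _ ≤ 2 ^ d * |2 * (y₂.map (B i)).sum - (y₁.map (B i)).sum| +
            |2 ^ d * (y₁.map (B i)).sum - (y.map (B i)).sum| := by
          grw [abs_add_le, abs_mul, abs_of_nonneg (by positivity : (0 : ℝ) ≤ 2 ^ d)]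
      _ ≤ 2 ^ d * hdisc B w + (2 ^ d - 1) * hdisc B w := by gcongr; exacts [hhalf i, hd i]
      _ = (2 ^ (d + 1) - 1) * hdisc B w := by ring

/-- The row of ones in the query matrix controls the size of the summary. -/
theorem exists_summary [Finite U] {m : ℕ} (Q : Fin m → BoolQuery U) (x : Dataset U n) (d : ℕ) :
    ∃ y : Multiset U, 2 ^ d * (y.card : ℝ) ≤ n + (2 ^ d - 1) * hdiscStar Q n ∧
      ∀ j, |2 ^ d * ((y.countP fun u => Q j u : ℕ) : ℝ) - count (Q j) x| ≤
        (2 ^ d - 1) * hdiscStar Q n := by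
  obtain ⟨y, -, hy⟩ := exists_iterated_half (appendOnes (queryMatrix Q)) (w := n)
    (y := Finset.univ.val.map x) (by simp) d
  refine ⟨y, ?_, fun j => ?_⟩
  · have hlast := (le_abs_self _).trans (hy (Fin.last m))
    simp only [appendOnes_last, Multiset.map_const', Multiset.sum_replicate, nsmul_eq_mul, mul_one,
      Multiset.card_map, Finset.card_val, Finset.card_univ, Fintype.card_fin] at hlast
    rw [hdiscStar]
    linarith
  · have hj := hy j.castSucc
    rw [appendOnes_castSucc, sum_map_truth, Multiset.map_map] at hj
    rw [cast_count]
    exact hj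

variable {P : Schedule} {x : Dataset U n} {m : ℕ} {t : Transcript U m} {k : ℕ}

/-- Some candidate summary of stage `k` is accurate on the transcript. -/
def Fits [Fintype U] [DecidableEq U] (P : Schedule) (x : Dataset U n) {m : ℕ}
    (t : Transcript U m) (k : ℕ) : Prop :=
  ∃ y ∈ candidates U k, Accurate P x k y t

variable [Fintype U] [DecidableEq U]

theorem fits_of_le
    (hcard : (n : ℝ) + (2 ^ (P.depth - k) - 1) * hdiscStar (fun j => (t j).1) n ≤
      2 ^ (P.depth - k) * 2 ^ (k + 1))
    (htol : (2 ^ (P.depth - k) - 1) * hdiscStar (fun j => (t j).1) n ≤ P.tol k) :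
    Fits P x t k := by
  obtain ⟨y, hy, hclose⟩ := exists_summary (fun j => (t j).1) x (P.depth - k)
  refine ⟨y, mem_smallMultisets ?_, fun j => ?_⟩
  · exact_mod_cast le_of_mul_le_mul_left (hy.trans hcard) (by positivity)
  · have hmin : (count (t j).1 x : ℝ) = min (n : ℝ) (count (t j).1 x) :=
      (min_eq_right (by exact_mod_cast count_le _ x)).symm
    rw [guess, hmin]
    push_cast
    exact ((abs_min_sub_min_le_max _ _ _ _).trans_eq (by simp)).trans ((hclose j).trans htol)

theorem fits_depth (hn : n ≤ 2 ^ P.depth) : Fits P x t P.depth := by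
  have hn' : (n : ℝ) ≤ 2 ^ P.depth := by exact_mod_cast hn
  refine fits_of_le ?_ (by simp [P.tol_nonneg])
  simp only [tsub_self, pow_zero, sub_self, zero_mul, add_zero, one_mul, pow_succ]
  linarith

theorem pow_mul_min_le_of_not_fits [Nonempty U] (hn : 1 ≤ n) (hd : n ≤ 2 ^ P.depth)
    (hd' : 2 ^ P.depth ≤ 2 * n) (hk : k ≤ P.depth) (hfit : ¬ Fits P x t k) :
    2 ^ k * min 1 (P.tol k / n) ≤ 2 * hdiscStar (fun j => (t j).1) n := by
  contrapose! hfit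
  have hH : 1 ≤ hdiscStar (fun j => (t j).1) n := one_le_hdiscStar _ hn
  set H := hdiscStar (fun j => (t j).1) n with hHdef
  have hn0 : (0 : ℝ) < n := by exact_mod_cast hn
  have hd : (n : ℝ) ≤ 2 ^ P.depth := by exact_mod_cast hd
  have hd' : (2 : ℝ) ^ P.depth ≤ 2 * n := by exact_mod_cast hd'
  have hpow : (2 : ℝ) ^ (P.depth - k) * 2 ^ k = 2 ^ P.depth := by
    rw [← pow_add, Nat.sub_add_cancel hk]
  have hHk : 2 * H < 2 ^ k :=
    hfit.trans_le (mul_le_of_le_one_right (by positivity) (min_le_left _ _))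
  have hHtol : 2 * H * n < 2 ^ k * P.tol k := by
    have := hfit.trans_le (mul_le_mul_of_nonneg_left (min_le_right _ _) (by positivity))
    rwa [← mul_div_assoc, lt_div_iff₀ hn0] at this
  refine fits_of_le ?_ ?_ <;> rw [← hHdef]
  · have : (2 : ℝ) ^ (P.depth - k) * H ≤ 2 ^ P.depth := by
      rw [← hpow]
      gcongr
      linarith
    rw [pow_succ, ← mul_assoc, hpow]
    linarith
  · have : 2 ^ (P.depth - k) * H ≤ P.tol k := by
      refine le_of_mul_le_mul_right ?_ (by positivity : (0 : ℝ) < 2 ^ k)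
      calc (2 : ℝ) ^ (P.depth - k) * H * 2 ^ k = 2 ^ P.depth * H := by rw [← hpow]; ring
        _ ≤ 2 * n * H := by gcongr
        _ ≤ P.tol k * 2 ^ k := by linarith
    linarith

/-- `k + 1` is the first stage that fits. -/
theorem exists_fits [Nonempty U] (hn : 1 ≤ n) (hd : n ≤ 2 ^ P.depth) (hd' : 2 ^ P.depth ≤ 2 * n)
    (x : Dataset U n) (t : Transcript U m) :
    Fits P x t 0 ∨ ∃ k, k < P.depth ∧ Fits P x t (k + 1) ∧
      2 ^ k * min 1 (P.tol k / n) ≤ 2 * hdiscStar (fun j => (t j).1) n := by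
  classical
  have hex : ∃ k, Fits P x t k := ⟨_, fits_depth hd⟩
  have hfit := Nat.find_spec hex
  have hle : Nat.find hex ≤ P.depth := Nat.find_min' hex (fits_depth hd)
  rcases hfind : Nat.find hex with _ | k
  · exact .inl (hfind ▸ hfit)
  · rw [hfind] at hfit hle
    exact .inr ⟨k, hle, hfit, pow_mul_min_le_of_not_fits hn hd hd' (by lia)
      (Nat.find_min hex (by lia))⟩

end

/-! ### The error in terms of the discrepancy -/

section

variable {U : Type u} [Fintype U] [DecidableEq U] {n : ℕ} {P : Schedule} {x : Dataset U n} {m k : ℕ}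
  {t : Transcript U m}

theorem Sound.maxError_le (ht : Sound P x k t) {l : ℕ} (hl : Fits P x t l) :
    maxError (fun j => (t j).1) (fun j => (t j).2) x ≤ min (5 * P.tol l / n) 1 := by
  obtain ⟨y, hy, hacc⟩ := hl
  have hkl : k ≤ l := le_of_not_gt fun hlk => ht.earlier l hlk y hy hacc
  have htol := P.tol_nonneg l
  refine (pi_norm_le_iff_of_nonneg (by positivity)).2 fun i => (ht.near i).trans ?_
  gcongr
  exact P.tol_mono hkl

theorem Sound.exists_stage [Nonempty U] (ht : Sound P x k t) (hn : 1 ≤ n) (hd : n ≤ 2 ^ P.depth)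
    (hd' : 2 ^ P.depth ≤ 2 * n) (htol : ∀ l, P.tol (l + 1) ≤ 3 * P.tol l) :
    ∃ l ≤ P.depth, 2 ^ l * min 1 (P.tol l / n) ≤ 2 * hdiscStar (fun j => (t j).1) n ∧
      maxError (fun j => (t j).1) (fun j => (t j).2) x ≤ 15 * min 1 (P.tol l / n) := by
  have hfac : ∀ {l v : ℝ}, v ≤ 15 * l → min (v / n) 1 ≤ 15 * min 1 (l / n) := fun {l v} hv => by
    rw [mul_min_of_nonneg _ _ (by norm_num), min_comm, ← mul_div_assoc]
    gcongr
    norm_num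
  rcases exists_fits hn hd hd' x t with hfit | ⟨l, hl, hfit, hH⟩
  · refine ⟨0, zero_le, ?_, (ht.maxError_le hfit).trans (hfac ?_)⟩
    · rw [pow_zero, one_mul]
      linarith [min_le_left 1 (P.tol 0 / n), one_le_hdiscStar (fun j => (t j).1) hn]
    · linarith [P.tol_nonneg 0]
  · exact ⟨l, hl.le, hH, (ht.maxError_le hfit).trans (hfac (by linarith [htol l]))⟩

end

/-! ### Schedules of doubling stages -/

section

theorem two_pow_clog_le {n : ℕ} (hn : 2 ≤ n) : 2 ^ Nat.clog 2 n ≤ 2 * n := by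
  rw [← Nat.sub_add_cancel (Nat.clog_pos one_lt_two hn), pow_succ']
  exact Nat.mul_le_mul_left 2 (Nat.pow_pred_clog_lt_self one_lt_two hn).le

/-- The schedule whose stages start from summaries of doubling size. The factor `k + 2` makes the
privacy costs of the stages summable. -/
def levelSchedule (n : ℕ) {γ w : ℝ} (hγ : 0 < γ) (hw : 0 ≤ w) : Schedule where
  depth := Nat.clog 2 n
  scale k := 1 / (γ * (k + 2) * √(2 ^ k))
  scale_pos k := by positivity
  scale_anti i j hij := by
    dsimp only
    gcongr
    norm_num
  width := w
  width_nonneg := hw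

variable {n : ℕ} {γ w : ℝ} {hγ : 0 < γ} {hw : 0 ≤ w}

theorem levelSchedule_tol (k : ℕ) :
    (levelSchedule n hγ hw).tol k = w * (γ * (k + 2) * √(2 ^ k)) := by
  rw [Schedule.tol, levelSchedule, div_div_eq_mul_div, div_one]

theorem levelSchedule_tol_succ_le (k : ℕ) :
    (levelSchedule n hγ hw).tol (k + 1) ≤ 3 * (levelSchedule n hγ hw).tol k := by
  have hsqrt : √(2 ^ (k + 1)) ≤ 3 / 2 * √(2 ^ k) := by
    rw [pow_succ', Real.sqrt_mul (by norm_num)]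
    gcongr
    rw [Real.sqrt_le_iff]
    norm_num
  rw [levelSchedule_tol, levelSchedule_tol]
  calc w * (γ * ((k + 1 : ℕ) + 2) * √(2 ^ (k + 1)))
      ≤ w * (γ * (2 * (k + 2)) * (3 / 2 * √(2 ^ k))) := by
        gcongr
        push_cast
        linarith [(k.cast_nonneg : (0 : ℝ) ≤ k)]
    _ = 3 * (w * (γ * (k + 2) * √(2 ^ k))) := by ring

variable {U : Type u} [Fintype U] [DecidableEq U]

theorem log_card_candidates_le (hU : 2 ≤ Fintype.card U) (k : ℕ) :
    (Nat.log 2 (candidates U k).card : ℝ) + 1 ≤ 8 * (2 ^ k * Real.log (Fintype.card U)) := by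
  set N := Fintype.card U
  have hN : 1 ≤ Real.logb 2 N := by
    rw [Real.le_logb_iff_rpow_le one_lt_two (by positivity), Real.rpow_one]
    exact_mod_cast hU
  have hcard : (candidates U k).card ≤ N ^ 2 ^ (k + 2) :=
    calc (candidates U k).card ≤ (N + 1) ^ 2 ^ (k + 1) := card_smallMultisets_le U _
      _ ≤ (N ^ 2) ^ 2 ^ (k + 1) := by gcongr; nlinarith
      _ = N ^ 2 ^ (k + 2) := by rw [← pow_mul, ← pow_succ']
  have hlog2 : 5 / 8 < Real.log 2 := by linarith [Real.log_two_gt_d9]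
  calc (Nat.log 2 (candidates U k).card : ℝ) + 1
      ≤ Real.logb 2 ((N ^ 2 ^ (k + 2) : ℕ) : ℝ) + 1 := by
        gcongr
        refine le_trans ?_ (Real.natLog_le_logb _ 2)
        exact_mod_cast Nat.log_mono_right hcard
    _ ≤ 2 ^ (k + 2) * Real.logb 2 N + 2 ^ k * Real.logb 2 N := by
        rw [Nat.cast_pow, Real.logb_pow, Nat.cast_pow, Nat.cast_ofNat]
        gcongr
        exact one_le_mul_of_one_le_of_one_le (one_le_pow₀ one_le_two) hN
    _ = 2 ^ k * (5 * (Real.log N / Real.log 2)) := by rw [Real.logb]; ring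
    _ ≤ 2 ^ k * (8 * Real.log N) := by
        refine mul_le_mul_of_nonneg_left ?_ (by positivity)
        rw [← mul_div_assoc, div_le_iff₀ (by linarith)]
        nlinarith [Real.log_natCast_nonneg N]
    _ = 8 * (2 ^ k * Real.log N) := by ring

theorem momentCost_levelSchedule_mul_le (hU : 2 ≤ Fintype.card U) {l : ℕ} {a : ℝ}
    (ha : 100 * (l + 1) ^ 2 * Real.log (Fintype.card U) ≤ a * γ ^ 2) (k : ℕ) :
    momentCost l (5 * (levelSchedule n hγ hw).scale k) * (Nat.log 2 (candidates U k).card + 1) ≤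
      a / ((k + 1) * (k + 2)) := by
  have ha0 : 0 ≤ a := nonneg_of_mul_nonneg_left ((by positivity : (0 : ℝ) ≤ _).trans ha)
    (by positivity)
  calc momentCost l (5 * (levelSchedule n hγ hw).scale k) * (Nat.log 2 (candidates U k).card + 1)
      ≤ momentCost l (5 * (levelSchedule n hγ hw).scale k) *
          (8 * (2 ^ k * Real.log (Fintype.card U))) := by
        gcongr
        exacts [momentCost_nonneg _ _, log_card_candidates_le hU k]
    _ = 100 * (l + 1) ^ 2 * Real.log (Fintype.card U) / (γ ^ 2 * (k + 2) ^ 2) := by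
        simp only [momentCost, levelSchedule, mul_pow, div_pow, one_pow,
          Real.sq_sqrt (by positivity : (0 : ℝ) ≤ 2 ^ k)]
        field_simp
        ring
    _ ≤ a * γ ^ 2 / (γ ^ 2 * (k + 2) ^ 2) := by gcongr
    _ = a / ((k + 2) * (k + 2)) := by field_simp
    _ ≤ a / ((k + 1) * (k + 2)) := by gcongr; norm_num

theorem halving_levelSchedule_isPrivate (hU : 2 ≤ Fintype.card U) {l : ℕ} {ε δ : ℝ} (hδ : 0 < δ)
    (hl : 2 * Real.log (1 / δ) ≤ l * ε)
    (hγl : 100 * (l + 1) ^ 2 * Real.log (Fintype.card U) ≤ Real.log (1 / δ) * γ ^ 2) (m : ℕ) :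
    (halving (levelSchedule n hγ hw) U n).algorithm.IsPrivate m ε δ := by
  have hcost := momentCost_levelSchedule_mul_le (n := n) (hγ := hγ) (hw := hw) hU hγl
  refine (halving_budget hcost).isPrivate (fun x x' hx => halving_dominated hx) ?_ m
  have hstart : budget (levelSchedule n hγ hw) l (Real.log (1 / δ))
      (halving (levelSchedule n hγ hw) U n).start ≤ Real.log (1 / δ) :=
    (budget_candidates_le (hcost 0)).trans_eq (by rw [Nat.cast_zero, zero_add, div_one])
  calc _ ≤ Real.exp (-Real.log (1 / δ)) := Real.exp_le_exp.2 (by linarith)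
    _ = δ := by rw [one_div, Real.log_inv, neg_neg, Real.exp_log hδ]

end

/-! ### The error rate of the halving mechanism -/

section

theorem le_rpow_of_cube_le {a K F : ℝ} (ha : 0 ≤ a) (hK : 0 ≤ K) (hF : 0 ≤ F)
    (h : a ^ 3 ≤ K * F ^ 2) : a ≤ K ^ (1 / 3 : ℝ) * F ^ (2 / 3 : ℝ) := by
  calc a = (a ^ 3) ^ (1 / 3 : ℝ) := by
        rw [← Real.rpow_natCast a 3, ← Real.rpow_mul ha]
        norm_num
    _ ≤ (K * F ^ 2) ^ (1 / 3 : ℝ) := by gcongr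
    _ = K ^ (1 / 3 : ℝ) * F ^ (2 / 3 : ℝ) := by
        rw [Real.mul_rpow hK (by positivity), ← Real.rpow_natCast F 2, ← Real.rpow_mul hF]
        norm_num

/-- The constant by which the tolerated noise exceeds the logarithm of the error rate. -/
def widthConst : ℝ := Real.log 4 / Real.log (Real.log 3) + 1

/-- The constant by which the number of stages exceeds `log n`. -/
def depthConst : ℝ := 3 + 1 / Real.log 2

/-- The constant by which the order of the moment exceeds `log (1 / δ) / ε`. -/
def orderConst (δ₀ : ℝ) : ℝ := 2 + 2 / Real.log (1 / δ₀)

/-- The constant of the error bound. -/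
def rateConst (δ₀ : ℝ) : ℝ :=
  15 * (2 * (10 * orderConst δ₀ * widthConst * depthConst) ^ 2) ^ (1 / 3 : ℝ)

theorem log_one_div_pos {δ : ℝ} (hδ : 0 < δ) (hδ1 : δ < 1) : 0 < Real.log (1 / δ) :=
  Real.log_pos ((one_lt_div hδ).2 hδ1)

theorem one_lt_log {a : ℝ} (ha : 3 ≤ a) : 1 < Real.log a :=
  (Real.lt_log_iff_exp_lt (by linarith)).2 (Real.exp_one_lt_three.trans_le ha)

theorem log_log_three_pos : 0 < Real.log (Real.log 3) := Real.log_pos (one_lt_log le_rfl)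

theorem widthConst_pos : 0 < widthConst := by
  have := log_log_three_pos
  have := Real.log_pos (by norm_num : (1 : ℝ) < 4)
  rw [widthConst]
  positivity

theorem depthConst_pos : 0 < depthConst := by
  have := Real.log_pos one_lt_two
  rw [depthConst]
  positivity

theorem orderConst_pos {δ₀ : ℝ} (h0 : 0 < δ₀) (h1 : δ₀ < 1) : 0 < orderConst δ₀ := by
  have := log_one_div_pos h0 h1
  rw [orderConst]
  positivity

theorem rateConst_pos {δ₀ : ℝ} (h0 : 0 < δ₀) (h1 : δ₀ < 1) : 0 < rateConst δ₀ := by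
  have := orderConst_pos h0 h1
  have := widthConst_pos
  have := depthConst_pos
  rw [rateConst]
  positivity

variable {n m : ℕ} {β : ℝ}

theorem log_log_three_add_le (hn : 3 ≤ n) (hm : 1 ≤ m) (hβ : 0 < β) :
    Real.log (Real.log 3) + Real.log (m / β) ≤ Real.log (m * Real.log n / β) := by
  have hlog3 : 1 < Real.log 3 := one_lt_log le_rfl
  have hlog : Real.log 3 ≤ Real.log n := Real.log_le_log (by norm_num) (by exact_mod_cast hn)
  have : (0 : ℝ) < m := by positivity
  rw [← Real.log_mul (by linarith) (by positivity), mul_div_right_comm, mul_comm (m / β)]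
  exact Real.log_le_log (by positivity) (by gcongr)

theorem log_div_nonneg (hm : 1 ≤ m) (hβ : 0 < β) (hβ1 : β < 1) : 0 ≤ Real.log (m / β) :=
  Real.log_nonneg ((one_le_div hβ).2 (hβ1.le.trans (by exact_mod_cast hm)))

theorem log_rate_pos (hn : 3 ≤ n) (hm : 1 ≤ m) (hβ : 0 < β) (hβ1 : β < 1) :
    0 < Real.log (m * Real.log n / β) := by
  linarith [log_log_three_add_le hn hm hβ, log_div_nonneg hm hβ hβ1, log_log_three_pos]

theorem log_four_mul_le (hn : 3 ≤ n) (hm : 1 ≤ m) (hβ : 0 < β) (hβ1 : β < 1) :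
    Real.log (4 * m / β) ≤ widthConst * Real.log (m * Real.log n / β) := by
  have hadd := log_log_three_add_le hn hm hβ
  have hdiv := log_div_nonneg hm hβ hβ1
  have hlog3 := log_log_three_pos
  have hlog4 : Real.log 4 ≤ Real.log 4 / Real.log (Real.log 3) * Real.log (m * Real.log n / β) := by
    rw [div_mul_eq_mul_div, le_div_iff₀ hlog3]
    exact mul_le_mul_of_nonneg_left (by linarith) (Real.log_nonneg (by norm_num))
  have : (0 : ℝ) < m := by positivity
  rw [mul_div_assoc, Real.log_mul (by norm_num) (by positivity), widthConst, add_mul, one_mul]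
  linarith

theorem clog_add_two_le (hn : 3 ≤ n) : (Nat.clog 2 n : ℝ) + 2 ≤ depthConst * Real.log n := by
  have hlog : 1 < Real.log n := one_lt_log (by exact_mod_cast hn)
  have hlog2 : 0 < Real.log 2 := Real.log_pos one_lt_two
  have hpow : (2 : ℝ) ^ Nat.clog 2 n ≤ 2 * n := by exact_mod_cast two_pow_clog_le (by lia)
  have hclog := Real.log_le_log (by positivity) hpow
  rw [Real.log_pow, Real.log_mul (by norm_num) (by positivity), ← le_div_iff₀ hlog2, add_div,
    div_self hlog2.ne'] at hclog
  rw [depthConst, add_mul, one_div_mul_eq_div]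
  linarith

theorem exists_order {D₀ D ε : ℝ} (hD₀ : 0 < D₀) (hD : D₀ ≤ D) (hε : 0 < ε) (hε1 : ε ≤ 1) :
    ∃ l : ℕ, 2 * D ≤ l * ε ∧ (l : ℝ) + 1 ≤ (2 + 2 / D₀) * (D / ε) := by
  have hD0 : 0 < D := hD₀.trans_le hD
  refine ⟨⌈2 * D / ε⌉₊, (div_le_iff₀ hε).1 (Nat.le_ceil _), ?_⟩
  have hone : 2 ≤ 2 / D₀ * (D / ε) := by
    rw [div_mul_div_comm, le_div_iff₀ (by positivity)]
    nlinarith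
  calc (⌈2 * D / ε⌉₊ : ℝ) + 1 ≤ 2 * D / ε + 1 + 1 := by
        gcongr
        exact (Nat.ceil_lt_add_one (by positivity)).le
    _ ≤ (2 + 2 / D₀) * (D / ε) := by rw [add_mul, ← mul_div_assoc]; linarith

theorem three_mul_add_one_mul_exp_neg_le (hm : 1 ≤ m) (hβ : 0 < β) :
    (3 * (m : ℝ) + 1) * Real.exp (-Real.log (4 * m / β)) ≤ β := by
  have hm' : (1 : ℝ) ≤ m := by exact_mod_cast hm
  rw [Real.exp_neg, Real.exp_log (by positivity), inv_div, ← mul_div_assoc,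
    div_le_iff₀ (by positivity)]
  nlinarith

/-- Each of the factors `√(2 ^ k)` and `μ ≤ 2H / 2 ^ k` of `μ ^ 3` depends on the stage, but their
product does not. -/
theorem cube_le_of_le_tol {γ w : ℝ} {hγ : 0 < γ} {hw : 0 ≤ w} {k : ℕ} {μ H : ℝ} (hn : 3 ≤ n)
    (hk : k ≤ Nat.clog 2 n) (hμ0 : 0 ≤ μ) (hμ : μ ≤ (levelSchedule n hγ hw).tol k / n)
    (hH : 2 ^ k * μ ≤ 2 * H) :
    μ ^ 3 ≤ 2 * (w * γ * depthConst * Real.log n / n) ^ 2 * H := by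
  have := one_lt_log (a := n) (by exact_mod_cast hn)
  have := depthConst_pos
  have hroot : μ ≤ w * γ * depthConst * Real.log n / n * √(2 ^ k) := by
    have hk' : (k : ℝ) + 2 ≤ depthConst * Real.log n := by
      refine le_trans ?_ (clog_add_two_le hn)
      gcongr
    calc μ ≤ w * (γ * (k + 2) * √(2 ^ k)) / n := by rwa [← levelSchedule_tol (hγ := hγ) (hw := hw)]
      _ ≤ w * (γ * (depthConst * Real.log n) * √(2 ^ k)) / n := by gcongr
      _ = w * γ * depthConst * Real.log n / n * √(2 ^ k) := by ring
  calc μ ^ 3 = μ ^ 2 * μ := by ring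
    _ ≤ (w * γ * depthConst * Real.log n / n * √(2 ^ k)) ^ 2 * μ := by gcongr
    _ = (w * γ * depthConst * Real.log n / n) ^ 2 * (2 ^ k * μ) := by
        rw [mul_pow, Real.sq_sqrt (by positivity), mul_assoc]
    _ ≤ (w * γ * depthConst * Real.log n / n) ^ 2 * (2 * H) := by gcongr
    _ = 2 * (w * γ * depthConst * Real.log n / n) ^ 2 * H := by ring

/-- The factor with which the level schedule is private, for moments of order at most
`κ log (1 / δ) / ε`. -/
def privacyFactor (κ : ℝ) (N : ℕ) (ε δ : ℝ) : ℝ :=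
  10 * κ * √(Real.log N * Real.log (1 / δ)) / ε

variable {κ ε δ : ℝ} {N : ℕ}

theorem privacyFactor_pos (hκ : 0 < κ) (hN : 2 ≤ N) (hε : 0 < ε) (hδ : 0 < Real.log (1 / δ)) :
    0 < privacyFactor κ N ε δ := by
  have := Real.log_pos (Nat.one_lt_cast.2 hN : (1 : ℝ) < N)
  rw [privacyFactor]
  positivity

theorem order_sq_mul_log_le {l : ℕ} (hδ : 0 ≤ Real.log (1 / δ))
    (hl : (l : ℝ) + 1 ≤ κ * (Real.log (1 / δ) / ε)) :
    100 * (l + 1) ^ 2 * Real.log N ≤ Real.log (1 / δ) * privacyFactor κ N ε δ ^ 2 := by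
  calc 100 * ((l : ℝ) + 1) ^ 2 * Real.log N
      ≤ 100 * (κ * (Real.log (1 / δ) / ε)) ^ 2 * Real.log N := by gcongr
    _ = Real.log (1 / δ) * privacyFactor κ N ε δ ^ 2 := by
        rw [privacyFactor, div_pow, mul_pow _ (√_), Real.sq_sqrt (by positivity)]
        ring

theorem error_le_of_le_tol {k : ℕ} {μ H : ℝ} (hn : 3 ≤ n) (hm : 1 ≤ m) (hκ : 0 < κ) (hε : 0 < ε)
    (hδ : 0 ≤ Real.log (1 / δ)) (hβ : 0 < β) (hβ1 : β < 1)
    {hγ : 0 < privacyFactor κ N ε δ} {hw : 0 ≤ Real.log (4 * m / β)} (hk : k ≤ Nat.clog 2 n)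
    (hμ0 : 0 ≤ μ) (hμ : μ ≤ (levelSchedule n hγ hw).tol k / n) (hH : 2 ^ k * μ ≤ 2 * H) :
    μ ≤ (2 * (10 * κ * widthConst * depthConst) ^ 2) ^ (1 / 3 : ℝ) *
      errorRate H N n m ε δ β ^ (2 / 3 : ℝ) := by
  have hwidth := widthConst_pos
  have hdepth := depthConst_pos
  have hlog := one_lt_log (a := n) (by exact_mod_cast hn)
  have hrate := log_rate_pos hn hm hβ hβ1
  have hH0 : 0 ≤ H := by linarith [mul_nonneg (pow_nonneg zero_le_two k) hμ0]
  refine le_rpow_of_cube_le hμ0 (by positivity) (by rw [errorRate]; positivity) ?_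
  calc μ ^ 3
      ≤ 2 * (Real.log (4 * m / β) * privacyFactor κ N ε δ * depthConst * Real.log n / n) ^ 2 * H :=
        cube_le_of_le_tol hn hk hμ0 hμ hH
    _ ≤ 2 * (widthConst * Real.log (m * Real.log n / β) * privacyFactor κ N ε δ * depthConst *
          Real.log n / n) ^ 2 * H := by
        gcongr
        exact log_four_mul_le hn hm hβ hβ1
    _ = 2 * (10 * κ * widthConst * depthConst) ^ 2 * errorRate H N n m ε δ β ^ 2 := by
        simp only [privacyFactor, errorRate, div_pow, mul_pow]
        rw [Real.sq_sqrt (by positivity), Real.sq_sqrt (by positivity)]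
        ring

theorem exists_private_of_two_le_card {U : Type u} [Fintype U] (hU : 2 ≤ Fintype.card U) {δ₀ : ℝ}
    (hδ₀ : δ₀ < 1) (hn : 3 ≤ n) (hm : 1 ≤ m) (hε : 0 < ε) (hε1 : ε ≤ 1) (hδ : 0 < δ)
    (hδδ₀ : δ ≤ δ₀) (hβ : 0 < β) (hβ1 : β < 1) :
    ∃ M : InteractiveAlgorithm U n, M.IsPrivate m ε δ ∧
      ∀ (A : AdaptiveAnalyst U) (x : Dataset U n), ENNReal.ofReal (1 - β) ≤
        trans M A m x {t | maxError (fun j => (t j).1) (fun j => (t j).2) x ≤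
          rateConst δ₀ * errorRate (hdiscStar (fun j => (t j).1) n) (Fintype.card U) n m ε δ β
            ^ (2 / 3 : ℝ)} := by
  classical
  have hNe : Nonempty U := Fintype.card_pos_iff.1 (by lia)
  have hδ₀0 : 0 < δ₀ := hδ.trans_le hδδ₀
  have hκ := orderConst_pos hδ₀0 hδ₀
  have hD := log_one_div_pos hδ (hδδ₀.trans_lt hδ₀)
  have hγ := privacyFactor_pos hκ hU hε hD
  have hw : 0 ≤ Real.log (4 * m / β) := by
    simpa using log_div_nonneg (m := 4 * m) (by lia) hβ hβ1
  obtain ⟨l, hl, hlκ⟩ := exists_order (log_one_div_pos hδ₀0 hδ₀)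
    (Real.log_le_log (by positivity) (one_div_le_one_div_of_le hδ hδδ₀)) hε hε1
  refine ⟨(halving (levelSchedule n hγ hw) U n).algorithm,
    halving_levelSchedule_isPrivate hU hδ hl (order_sq_mul_log_le hD.le hlκ) m, fun A x => ?_⟩
  refine (ENNReal.ofReal_le_ofReal ?_).trans (halving_accurate _ A x fun k t ht => ?_)
  · exact sub_le_sub_left (three_mul_add_one_mul_exp_neg_le hm hβ) 1
  · obtain ⟨k, hk, hH, herr⟩ := ht.exists_stage (by lia) (Nat.le_pow_clog one_lt_two n)
      (two_pow_clog_le (by lia)) levelSchedule_tol_succ_le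
    rw [Set.mem_ofPred_eq, rateConst, mul_assoc]
    refine herr.trans (mul_le_mul_of_nonneg_left ?_ (by norm_num))
    have htol := div_nonneg ((levelSchedule n hγ hw).tol_nonneg k) (n.cast_nonneg (α := ℝ))
    exact error_le_of_le_tol hn hm hκ hε hD.le hβ hβ1 hk (le_min zero_le_one htol)
      (min_le_right _ _) hH

end

/-! ### Universes with at most one element -/

section

/-- The mechanism that answers each query `q` by `v q`, whatever the dataset. -/
def obliviousMechanism (n : ℕ) {U : Type u} (v : BoolQuery U → ℝ) :
    SparseMechanism U n PUnit Empty where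
  start := PUnit.unit
  fresh _ := PMF.pure 0
  outcome _ _ _ _ := PMF.pure none
  next σ _ _ := σ
  reply _ q _ := v q

theorem exists_private_of_subsingleton {U : Type u} [Finite U] [Subsingleton U] {n m : ℕ}
    {ε δ β : ℝ} {f : Transcript U m → ℝ} (hβ : 0 < β) (hf : ∀ t, 0 ≤ f t) :
    ∃ M : InteractiveAlgorithm U n, M.IsPrivate m ε δ ∧
      ∀ (A : AdaptiveAnalyst U) (x : Dataset U n), ENNReal.ofReal (1 - β) ≤
        trans M A m x {t | maxError (fun j => (t j).1) (fun j => (t j).2) x ≤ f t} := by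
  obtain ⟨v, hv⟩ : ∃ v : BoolQuery U → ℝ, ∀ q (x : Dataset U n), v q = queryValue q x := by
    rcases isEmpty_or_nonempty (Dataset U n) with _ | ⟨⟨x⟩⟩
    · exact ⟨0, fun _ x => isEmptyElim x⟩
    · exact ⟨fun q => queryValue q x, fun q y => by rw [Subsingleton.elim x y]⟩
  refine ⟨(obliviousMechanism n v).algorithm, ?_, fun A x => ?_⟩
  · rintro A x x' ⟨i, hi, -⟩
    exact absurd (Subsingleton.elim _ _) hi
  have hexact := SparseMechanism.le_trans_of_good (M := obliviousMechanism n v) (x := x)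
    (b₁ := 0) (b := 0) (good := fun j _ _ => {t | ∀ i, (t i).2 = queryValue (t i).1 x})
    (m := m) (s := {t | maxError (fun j => (t j).1) (fun j => (t j).2) x ≤ f t})
    ?_ ?_ ?_ A ?_
  · refine le_trans ?_ hexact
    simp only [mul_zero, add_zero, tsub_zero]
    exact ENNReal.ofReal_le_one.2 (by linarith)
  · intro j _ _
    have hvalue : Measurable fun q : BoolQuery U => queryValue q x := .of_discrete
    refine measurableSet_setOfPred.2 (.forall fun i => ?_)
    exact measurableSet_setOfPred.1 (measurableSet_eq_fun (by fun_prop) (by fun_prop))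
  · simp
  · intro j σ r t q ht
    have hgood : ∀ i, (Fin.snoc (α := fun _ => BoolQuery U × ℝ) t (q, v q) i).2 =
        queryValue (Fin.snoc (α := fun _ => BoolQuery U × ℝ) t (q, v q) i).1 x :=
      Fin.lastCases (by simp [hv q x]) fun i => by simpa using ht i
    simp [obliviousMechanism, hgood]
  · intro _ _ t ht
    refine le_trans (le_of_eq ?_) (hf t)
    rw [maxError, norm_eq_zero]
    exact funext fun j => sub_eq_zero.2 (ht j).symm

end

/-! ### Partial colourings -/

section

variable {U : Type u} {n k w : ℕ} {B : Matrix (Fin k) U ℝ} {S : Finset U} {b : ℝ} {χ χ' : U → ℤ}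

theorem hdisc_le_of_coloring [Fintype U] (hb : 0 ≤ b)
    (h : ∀ S : Finset U, S.card ≤ w → ∃ χ, IsColoring S χ ∧ ∀ i, |∑ u, B i u * χ u| ≤ b) :
    hdisc B w ≤ b := by
  have : Nonempty {S : Finset U // S.card ≤ w} := ⟨⟨∅, by simp⟩⟩
  refine ciSup_le fun ⟨S, hS⟩ => ?_
  obtain ⟨χ, hχ, hle⟩ := h S hS
  refine (ciInf_le (Set.finite_range _).bddBelow
    (fun v : S => if χ v = 1 then (1 : ℤˣ) else -1)).trans ?_
  refine (pi_norm_le_iff_of_nonneg hb).2 fun i => le_trans (le_of_eq ?_) (hle i)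
  rw [Real.norm_eq_abs, ← Finset.sum_subset (Finset.subset_univ S)
    (fun u _ hu => by simp [hχ.zero u hu]), ← Finset.sum_coe_sort S]
  congr 1
  refine Finset.sum_congr rfl fun v _ => ?_
  rcases hχ.sign v v.2 with h | h <;> simp [h]

/-- A colouring of at least an eighth of the columns in `S`, the colour `0` standing for an
uncoloured column. -/
structure IsPartialColoring (S : Finset U) (χ : U → ℤ) : Prop where
  color : ∀ u, χ u = 0 ∨ χ u = 1 ∨ χ u = -1
  zero : ∀ u ∉ S, χ u = 0
  card_le : S.card ≤ 8 * (S.filter fun u => χ u ≠ 0).card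

theorem IsPartialColoring.card_uncolored_le (hχ : IsPartialColoring S χ) :
    8 * (S.filter fun u => χ u = 0).card ≤ 7 * S.card := by
  have := hχ.card_le
  have := S.card_filter_add_card_filter_not fun u => χ u = 0
  lia

theorem IsPartialColoring.add (hχ : IsPartialColoring S χ)
    (hχ' : IsColoring (S.filter fun u => χ u = 0) χ') : IsColoring S (χ + χ') where
  sign u hu := by
    by_cases h0 : χ u = 0
    · simpa [h0] using hχ'.sign u (by simp [hu, h0])
    · simpa [hχ'.zero u (by simp [h0]), h0] using hχ.color u
  zero u hu := by simp [hχ.zero u hu, hχ'.zero u (by simp [hu])]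

theorem exists_coloring_of_card_le_one [Fintype U] (hB : ∀ i u, |B i u| ≤ 1) (hS : S.card ≤ 1) :
    ∃ χ, IsColoring S χ ∧ ∀ i, |∑ u, B i u * χ u| ≤ 1 := by
  classical
  refine ⟨fun u => if u ∈ S then 1 else 0, ⟨fun u hu => by simp [hu], fun u hu => by simp [hu]⟩,
    fun i => ?_⟩
  calc |∑ u, B i u * ((if u ∈ S then 1 else 0 : ℤ) : ℝ)|
      = |∑ u ∈ S, B i u| := by simp
    _ ≤ S.card • (1 : ℝ) := (Finset.abs_sum_le_sum_abs _ _).trans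
        (Finset.sum_le_card_nsmul _ _ 1 fun u _ => hB i u)
    _ ≤ 1 := by rw [nsmul_one]; exact_mod_cast hS

/-- Each partial colouring leaves at most `7 / 8` of the columns, so that at most one is left after
`r` rounds. -/
theorem exists_coloring_of_partial [Fintype U] (hB : ∀ i u, |B i u| ≤ 1) (hb : 0 ≤ b)
    (h : ∀ S : Finset U, 2 ≤ S.card → S.card ≤ w →
      ∃ χ, IsPartialColoring S χ ∧ ∀ i, |∑ u, B i u * χ u| ≤ b)
    (r : ℕ) (hSw : S.card ≤ w) (hS : S.card * 7 ^ r < 2 * 8 ^ r) :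
    ∃ χ, IsColoring S χ ∧ ∀ i, |∑ u, B i u * χ u| ≤ b * r + 1 := by
  induction r generalizing S with
  | zero => simpa using exists_coloring_of_card_le_one (S := S) hB (by lia)
  | succ r ih =>
    rcases le_or_gt S.card 1 with h1 | h1
    · obtain ⟨χ, hχ, hle⟩ := exists_coloring_of_card_le_one hB h1
      exact ⟨χ, hχ, fun i => (hle i).trans (le_add_of_nonneg_left (by positivity))⟩
    obtain ⟨χ, hχ, hle⟩ := h S h1 hSw
    have hcard := hχ.card_uncolored_le
    obtain ⟨χ', hχ', hle'⟩ := ih (S := S.filter fun u => χ u = 0) (by lia) (by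
      have := Nat.mul_le_mul_right (7 ^ r) hcard
      rw [pow_succ, pow_succ] at hS
      lia)
    refine ⟨χ + χ', hχ.add hχ', fun i => ?_⟩
    calc |∑ u, B i u * ((χ + χ') u : ℤ)|
        = |∑ u, B i u * χ u + ∑ u, B i u * χ' u| := by
          simp [mul_add, Finset.sum_add_distrib]
      _ ≤ b + (b * r + 1) := (abs_add_le _ _).trans (add_le_add (hle i) (hle' i))
      _ = b * (r + 1 : ℕ) + 1 := by push_cast; ring

theorem mul_seven_pow_ceil_lt (hn : 1 ≤ n) :
    n * 7 ^ ⌈8 * Real.log n⌉₊ < 2 * 8 ^ ⌈8 * Real.log n⌉₊ := by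
  set r := ⌈8 * Real.log n⌉₊
  have hn0 : (0 : ℝ) < n := by positivity
  have hr : 8 * Real.log n ≤ r := Nat.le_ceil _
  have hexp : (7 / 8 : ℝ) ≤ Real.exp (-(1 / 8)) := by
    linarith [Real.add_one_le_exp (-(1 / 8 : ℝ))]
  have hpow : (7 / 8 : ℝ) ^ r ≤ 1 / n := calc
    (7 / 8 : ℝ) ^ r ≤ Real.exp (-(1 / 8)) ^ r := by gcongr
    _ = Real.exp (r * -(1 / 8)) := (Real.exp_nat_mul _ _).symm
    _ ≤ Real.exp (-Real.log n) := Real.exp_le_exp.2 (by linarith)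
    _ = 1 / n := by rw [Real.exp_neg, Real.exp_log hn0, one_div]
  rw [div_pow, div_le_div_iff₀ (by positivity) hn0, one_mul] at hpow
  have hle : 7 ^ r * n ≤ 8 ^ r := by exact_mod_cast hpow
  have : 0 < 8 ^ r := by positivity
  lia

theorem abs_appendOnes_queryMatrix_le {m : ℕ} (Q : Fin m → BoolQuery U) (i : Fin (m + 1)) (u : U) :
    |appendOnes (queryMatrix Q) i u| ≤ 1 := by
  refine Fin.lastCases (by simp [appendOnes_last]) (fun j => ?_) i
  rw [appendOnes_castSucc, truth]
  split_ifs <;> simp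

/-- Otherwise `9 * log n` rounds of partial colouring would colour all the columns too well. -/
theorem exists_rigid_set [Fintype U] {m : ℕ} {Q : Fin m → BoolQuery U} (hn : 3 ≤ n)
    (hH : 2 ≤ hdiscStar Q n) :
    ∃ S : Finset U, 2 ≤ S.card ∧ S.card ≤ n ∧ ∀ χ, IsPartialColoring S χ →
      ∃ i, hdiscStar Q n / (20 * Real.log n) < |∑ u, appendOnes (queryMatrix Q) i u * χ u| := by
  by_contra! hcon
  have hlog : 1 < Real.log n := one_lt_log (by exact_mod_cast hn)
  set H := hdiscStar Q n
  set r := ⌈8 * Real.log n⌉₊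
  have hr : (r : ℝ) ≤ 9 * Real.log n := by
    linarith [Nat.ceil_lt_add_one (by positivity : 0 ≤ 8 * Real.log n)]
  have hle : H ≤ H / (20 * Real.log n) * r + 1 := by
    refine hdisc_le_of_coloring (by positivity) fun S hS => ?_
    exact exists_coloring_of_partial (abs_appendOnes_queryMatrix_le Q) (by positivity) hcon r hS
      ((Nat.mul_le_mul_right _ hS).trans_lt (mul_seven_pow_ceil_lt (by lia)))
  have : H / (20 * Real.log n) * r ≤ 9 / 20 * H := calc
    H / (20 * Real.log n) * r ≤ H / (20 * Real.log n) * (9 * Real.log n) := by gcongr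
    _ = 9 / 20 * H := by field
  linarith

end

/-! ### Reconstruction from private answers -/

section

theorem exists_measurable_nearest {α E : Type*} [Finite α] [Nonempty α] [MeasurableSpace α]
    [PseudoMetricSpace E] [MeasurableSpace E] [OpensMeasurableSpace E] (v : α → E) :
    ∃ D : E → α, Measurable D ∧ ∀ e a, dist (v (D e)) e ≤ dist (v a) e := by
  obtain ⟨g, hg⟩ := exists_surjective_nat α
  choose k hk using hg
  obtain ⟨N, hN⟩ := (Set.finite_range k).bddAbove
  refine ⟨fun e => g (SimpleFunc.nearestPtInd (v ∘ g) N e),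
    (measurable_from_nat (f := g)).comp (SimpleFunc.measurable _), fun e a => ?_⟩
  have hnear := SimpleFunc.edist_nearestPt_le (v ∘ g) e (hN (Set.mem_range_self a))
  rwa [Function.comp_apply, hk, edist_dist, edist_dist,
    ENNReal.ofReal_le_ofReal_iff dist_nonneg] at hnear

theorem sum_measureReal_le {ι R : Type*} [Fintype ι] [MeasurableSpace R] {μ : Measure R}
    [IsProbabilityMeasure μ] {A : ι → Set R} {s : Set R} {c : ℝ} (hA : ∀ i, MeasurableSet (A i))
    (hs : MeasurableSet s) (hc : 0 ≤ c) (h : ∀ r ∉ s, ∑ i, (A i).indicator 1 r ≤ c) :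
    ∑ i, μ.real (A i) ≤ c + Fintype.card ι * μ.real s := by
  have hint {t : Set R} (ht : MeasurableSet t) : Integrable (t.indicator (1 : R → ℝ)) μ :=
    (integrable_const 1).indicator ht
  calc ∑ i, μ.real (A i)
      = ∫ r, ∑ i, (A i).indicator 1 r ∂μ := by
        rw [integral_finsetSum _ fun i _ => hint (hA i)]
        exact Finset.sum_congr rfl fun i _ => (integral_indicator_one (hA i)).symm
    _ ≤ ∫ r, (c + Fintype.card ι * s.indicator 1 r) ∂μ := by
        refine integral_mono (integrable_finsetSum _ fun i _ => hint (hA i))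
          ((integrable_const c).add ((hint hs).const_mul _)) fun r => ?_
        by_cases hr : r ∈ s
        · refine le_add_of_nonneg_of_le hc ?_
          rw [Set.indicator_of_mem hr, Pi.one_apply, mul_one, ← nsmul_one]
          exact Finset.sum_le_card_nsmul _ _ _ fun i _ =>
            Set.indicator_le_self' (fun _ _ => zero_le_one) r
        · simpa [hr] using h r hr
    _ = c + Fintype.card ι * μ.real s := by
        rw [integral_add (integrable_const c) ((hint hs).const_mul _), integral_const_mul,
          integral_indicator_one hs]
        simp

variable {U : Type u} {n m d : ℕ} {R : Type*} [MeasurableSpace R] {M : Dataset U n → Measure R}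

theorem IsDP.real_le [∀ x, IsFiniteMeasure (M x)] {ε δ : ℝ} (hM : IsDP ε δ M) (hδ : 0 ≤ δ)
    {x x' : Dataset U n} (hx : Neighboring x x') {s : Set R} (hs : MeasurableSet s) :
    (M x).real s ≤ Real.exp ε * (M x').real s + δ := by
  have h := ENNReal.toReal_mono (by finiteness) (hM x x' hx s hs)
  rwa [ENNReal.toReal_add (by finiteness) (by finiteness), ENNReal.toReal_mul,
    ENNReal.toReal_ofReal (Real.exp_pos ε).le, ENNReal.toReal_ofReal hδ] at h

/-- The word `b` with its `i`-th bit flipped. -/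
def flipBit (b : Fin d → Bool) (i : Fin d) : Fin d → Bool := Function.update b i (!b i)

theorem flipBit_involutive (i : Fin d) : Function.Involutive fun b => flipBit b i := fun b => by
  simp [flipBit]

variable [∀ x, IsProbabilityMeasure (M x)] {X : (Fin d → Bool) → Dataset U n}
  {D : R → Fin d → Bool}

/-- Flipping the bit changes the law of the guess only a little, but turns a right guess into a
wrong one. -/
theorem one_sub_error_le (hM : IsDP (1 / 8) (1 / 8) M)
    (hX : ∀ b i, Neighboring (X b) (X (flipBit b i))) (hD : Measurable D) (b : Fin d → Bool)
    (i : Fin d) :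
    1 - (M (X b)).real {r | b i ≠ D r i} ≤
      8 / 7 * (M (X (flipBit b i))).real {r | flipBit b i i ≠ D r i} + 1 / 8 := by
  have hmeas (c : Bool) : MeasurableSet {r | c ≠ D r i} :=
    hD (MeasurableSet.of_discrete (s := {w : Fin d → Bool | c ≠ w i}))
  have hflip : {r | flipBit b i i ≠ D r i} = {r | b i ≠ D r i}ᶜ := by
    ext r
    cases h : b i <;> simp [flipBit, h]
  have hexp : Real.exp (1 / 8) ≤ 8 / 7 := by
    have h := Real.exp_bound_div_one_sub_of_interval (x := 1 / 8) (by norm_num) (by norm_num)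
    norm_num at h ⊢
    exact h
  calc 1 - (M (X b)).real {r | b i ≠ D r i}
      = (M (X b)).real {r | flipBit b i i ≠ D r i} := by
        rw [hflip, probReal_compl_eq_one_sub (hmeas _)]
    _ ≤ Real.exp (1 / 8) * (M (X (flipBit b i))).real {r | flipBit b i i ≠ D r i} + 1 / 8 :=
        hM.real_le (by norm_num) (hX b i) (hmeas _)
    _ ≤ _ := by gcongr

theorem exists_reconstruction_error (hM : IsDP (1 / 8) (1 / 8) M)
    (hX : ∀ b i, Neighboring (X b) (X (flipBit b i))) (hD : Measurable D) :
    ∃ b, (2 / 5 : ℝ) * d ≤ ∑ i, (M (X b)).real {r | b i ≠ D r i} := by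
  set err : (Fin d → Bool) → Fin d → ℝ := fun b i => (M (X b)).real {r | b i ≠ D r i}
  have hbit (i : Fin d) : 2 / 5 * (2 ^ d : ℝ) ≤ ∑ b, err b i := by
    have hsum : ∑ b, (1 - err b i) ≤ ∑ b, (8 / 7 * err (flipBit b i) i + 1 / 8) :=
      Finset.sum_le_sum fun b _ => one_sub_error_le hM hX hD b i
    have hflip : ∑ b, err (flipBit b i) i = ∑ b, err b i :=
      (flipBit_involutive i).bijective.sum_comp fun b => err b i
    rw [Finset.sum_sub_distrib, Finset.sum_add_distrib, ← Finset.mul_sum, hflip] at hsum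
    simp only [Finset.sum_const, Finset.card_univ, Fintype.card_pi, Fintype.card_bool,
      Finset.prod_const, Fintype.card_fin, nsmul_eq_mul] at hsum
    push_cast at hsum
    linarith [pow_pos (two_pos (α := ℝ)) d]
  obtain ⟨b, -, hb⟩ := Finset.exists_le_of_sum_le (s := Finset.univ)
    (f := fun _ : Fin d → Bool => (2 / 5 : ℝ) * d) (g := fun b => ∑ i, err b i)
    Finset.univ_nonempty <| calc
      ∑ _b : Fin d → Bool, (2 / 5 : ℝ) * d = ∑ _i : Fin d, 2 / 5 * (2 ^ d : ℝ) := by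
        simp
        ring
      _ ≤ ∑ i, ∑ b, err b i := Finset.sum_le_sum fun i _ => hbit i
      _ = ∑ b, ∑ i, err b i := Finset.sum_comm
  exact ⟨b, hb⟩

theorem exists_far_reconstruction (hd : 0 < d) (hM : IsDP (1 / 8) (1 / 8) M)
    (hX : ∀ b i, Neighboring (X b) (X (flipBit b i))) (hD : Measurable D) :
    ∃ b, (1 / 5 : ℝ) ≤ (M (X b)).real {r | 3 * d ≤ 16 * hammingDist b (D r)} := by
  obtain ⟨b, hb⟩ := exists_reconstruction_error hM hX hD
  refine ⟨b, ?_⟩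
  have hle := sum_measureReal_le (μ := M (X b)) (A := fun i => {r | b i ≠ D r i})
    (s := {r | 3 * d ≤ 16 * hammingDist b (D r)}) (c := 3 * d / 16)
    (fun i => hD (MeasurableSet.of_discrete (s := {w : Fin d → Bool | b i ≠ w i})))
    (hD (MeasurableSet.of_discrete (s := {w | 3 * d ≤ 16 * hammingDist b w}))) (by positivity) ?_
  · rw [Fintype.card_fin] at hle
    have hd' : (0 : ℝ) < d := by exact_mod_cast hd
    nlinarith
  · intro r hr
    have hcount : ∑ i, {r | b i ≠ D r i}.indicator (1 : R → ℝ) r = hammingDist b (D r) := by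
      simp only [hammingDist, ← Finset.sum_boole]
      exact Finset.sum_congr rfl fun i _ => by by_cases hi : b i = D r i <;> simp [hi]
    have hr : (16 : ℝ) * hammingDist b (D r) ≤ 3 * d := by exact_mod_cast (not_le.1 hr).le
    linarith

/-- The answers determine a guess for the word, namely the one whose exact answers are nearest. -/
theorem exists_error_of_separated {Q : Fin m → BoolQuery U} (hd : 0 < d)
    {M : Dataset U n → Measure (Fin m → ℝ)} [∀ x, IsProbabilityMeasure (M x)]
    (hM : IsDP (1 / 8) (1 / 8) M) {X : (Fin d → Bool) → Dataset U n}
    (hX : ∀ b i, Neighboring (X b) (X (flipBit b i))) {h : ℝ}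
    (hsep : ∀ b b', 3 * d ≤ 16 * hammingDist b b' →
      ∃ j, h ≤ |queryValue (Q j) (X b) - queryValue (Q j) (X b')|) :
    ∃ x, ENNReal.ofReal (h / 10) ≤ ∫⁻ a, ENNReal.ofReal (maxError Q a x) ∂(M x) := by
  set v : (Fin d → Bool) → Fin m → ℝ := fun b j => queryValue (Q j) (X b)
  obtain ⟨D, hD, hnear⟩ := exists_measurable_nearest v
  obtain ⟨b, hb⟩ := exists_far_reconstruction hd hM hX hD
  set far : Set (Fin m → ℝ) := {a | 3 * d ≤ 16 * hammingDist b (D a)}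
  have hfar : MeasurableSet far :=
    hD (MeasurableSet.of_discrete (s := {w | 3 * d ≤ 16 * hammingDist b w}))
  have hlarge (a) (ha : a ∈ far) : h / 2 ≤ maxError Q a (X b) := by
    obtain ⟨j, hj⟩ := hsep b (D a) ha
    have : h ≤ dist (v b) a + dist (v (D a)) a :=
      (hj.trans (dist_le_pi_dist (v b) (v (D a)) j)).trans (dist_triangle_right _ _ _)
    have : maxError Q a (X b) = dist (v b) a := (dist_eq_norm (v b) a).symm
    linarith [hnear a b]
  refine ⟨X b, ?_⟩
  calc ENNReal.ofReal (h / 10)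
      = ENNReal.ofReal (h / 2) * ENNReal.ofReal (1 / 5) := by
        rw [← ENNReal.ofReal_mul' (by norm_num)]
        ring_nf
    _ ≤ ENNReal.ofReal (h / 2) * M (X b) far := by
        gcongr
        exact ENNReal.ofReal_le_of_le_toReal hb
    _ = ∫⁻ a, far.indicator (fun _ => ENNReal.ofReal (h / 2)) a ∂(M (X b)) :=
        (lintegral_indicator_const hfar _).symm
    _ ≤ ∫⁻ a, ENNReal.ofReal (maxError Q a (X b)) ∂(M (X b)) := by
        exact lintegral_mono <| Set.indicator_le fun a ha => ENNReal.ofReal_le_ofReal (hlarge a ha)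

end

/-! ### Datasets built from pairs of elements -/

section

variable {U : Type u} {n d : ℕ} {f : Fin d × Bool → U} {S : Finset U}

/-- The dataset that stores the word `b` with one entry for each bit: the `i`-th entry is
`f (i, b i)` for `i < d`, and the remaining entries are `p`. -/
def pairDataset (f : Fin d × Bool → U) (p : U) (hdn : d ≤ n) (b : Fin d → Bool) : Dataset U n :=
  Function.extend (Fin.castLE hdn) (fun i => f (i, b i)) fun _ => p

theorem pairDataset_castLE (f : Fin d × Bool → U) (p : U) (hdn : d ≤ n) (b : Fin d → Bool)
    (i : Fin d) : pairDataset f p hdn b (Fin.castLE hdn i) = f (i, b i) :=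
  (Fin.castLE_injective hdn).extend_apply _ _ i

theorem pairDataset_of_notMem_range (f : Fin d × Bool → U) (p : U) (hdn : d ≤ n)
    (b : Fin d → Bool) {i : Fin n} (hi : i ∉ Set.range (Fin.castLE hdn)) :
    pairDataset f p hdn b i = p :=
  Function.extend_apply' _ _ i hi

theorem neighboring_pairDataset (hf : Function.Injective f) (p : U) (hdn : d ≤ n)
    (b : Fin d → Bool) (i : Fin d) :
    Neighboring (pairDataset f p hdn b) (pairDataset f p hdn (flipBit b i)) := by
  refine ⟨Fin.castLE hdn i, ?_, fun j hj => ?_⟩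
  · simp [pairDataset_castLE, hf.eq_iff, flipBit]
  · by_cases h : j ∈ Set.range (Fin.castLE hdn)
    · obtain ⟨k, rfl⟩ := h
      have hk : k ≠ i := ne_of_apply_ne _ hj
      rw [pairDataset_castLE, pairDataset_castLE, flipBit, Function.update_of_ne hk]
    · rw [pairDataset_of_notMem_range _ _ _ _ h, pairDataset_of_notMem_range _ _ _ _ h]

theorem queryValue_pairDataset_sub (f : Fin d × Bool → U) (p : U) (hdn : d ≤ n)
    (b b' : Fin d → Bool) (q : BoolQuery U) :
    queryValue q (pairDataset f p hdn b) - queryValue q (pairDataset f p hdn b') =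
      (∑ i, (truth q (f (i, b i)) - truth q (f (i, b' i)))) / n := by
  rw [queryValue, queryValue, ← sub_div, ← Finset.sum_sub_distrib]
  congr 1
  symm
  refine Finset.sum_of_injOn (Fin.castLE hdn) (Fin.castLE_injective hdn).injOn
    (fun _ _ => Finset.mem_coe.2 (Finset.mem_univ _)) (fun i _ hi => ?_) fun i _ => ?_
  · have h : i ∉ Set.range (Fin.castLE hdn) := by simpa using hi
    rw [pairDataset_of_notMem_range _ _ _ _ h, pairDataset_of_notMem_range _ _ _ _ h, sub_self]
  · rw [pairDataset_castLE, pairDataset_castLE]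

/-- The partial colouring that compares the words `b` and `b'`: where they differ in the `i`-th bit,
it gives `f (i, b i)` the colour `1` and `f (i, b' i)` the colour `-1`. -/
def pairColoring [DecidableEq U] (f : Fin d × Bool → U) (b b' : Fin d → Bool) (u : U) : ℤ :=
  ∑ i, ((if f (i, b i) = u then 1 else 0) - if f (i, b' i) = u then 1 else 0)

theorem sum_mul_pairColoring [Fintype U] [DecidableEq U] (f : Fin d × Bool → U)
    (b b' : Fin d → Bool) (g : U → ℝ) :
    ∑ u, g u * pairColoring f b b' u = ∑ i, (g (f (i, b i)) - g (f (i, b' i))) := by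
  simp only [pairColoring, Int.cast_sum, Finset.mul_sum]
  rw [Finset.sum_comm]
  exact Finset.sum_congr rfl fun i _ => by simp [mul_sub]

theorem pairColoring_apply [DecidableEq U] (hf : Function.Injective f) (b b' : Fin d → Bool)
    (i : Fin d) (c : Bool) : pairColoring f b b' (f (i, c)) =
      (if b i = c then 1 else 0) - if b' i = c then 1 else 0 := by
  rw [pairColoring, Finset.sum_eq_single i]
  · simp [hf.eq_iff]
  · intro k _ hk
    simp [hf.eq_iff, hk]
  · simp

theorem pairColoring_of_notMem_range [DecidableEq U] (b b' : Fin d → Bool) {u : U}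
    (hu : u ∉ Set.range f) : pairColoring f b b' u = 0 := by
  have h (k : Fin d × Bool) : f k ≠ u := fun hk => hu ⟨k, hk⟩
  simp [pairColoring, h]

theorem two_mul_hammingDist_le [DecidableEq U] (hf : Function.Injective f) (hS : ∀ k, f k ∈ S)
    (b b' : Fin d → Bool) :
    2 * hammingDist b b' ≤ (S.filter fun u => pairColoring f b b' u ≠ 0).card := by
  calc 2 * hammingDist b b'
      = ((({i | b i ≠ b' i} : Finset (Fin d)) ×ˢ (Finset.univ : Finset Bool)).image f).card := by
        rw [Finset.card_image_of_injective _ hf, Finset.card_product, hammingDist, mul_comm]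
        rfl
    _ ≤ _ := Finset.card_le_card fun u hu => ?_
  obtain ⟨⟨i, c⟩, hic, rfl⟩ := Finset.mem_image.1 hu
  have hi : b i ≠ b' i := by simpa using hic
  refine Finset.mem_filter.2 ⟨hS _, ?_⟩
  rw [pairColoring_apply hf]
  revert hi
  cases b i <;> cases b' i <;> cases c <;> simp

theorem isPartialColoring_pairColoring [DecidableEq U] (hf : Function.Injective f)
    (hS : ∀ k, f k ∈ S) {b b' : Fin d → Bool} (hb : S.card ≤ 16 * hammingDist b b') :
    IsPartialColoring S (pairColoring f b b') where
  color u := by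
    by_cases hu : u ∈ Set.range f
    · obtain ⟨⟨i, c⟩, rfl⟩ := hu
      rw [pairColoring_apply hf]
      split_ifs <;> simp
    · exact .inl (pairColoring_of_notMem_range b b' hu)
  zero u hu := pairColoring_of_notMem_range b b' fun ⟨k, hk⟩ => hu (hk ▸ hS k)
  card_le := by
    have := two_mul_hammingDist_le hf hS b b'
    lia

variable {m : ℕ} {Q : Fin m → BoolQuery U}

/-- The partial colouring that compares two words is balanced, hence its discrepancy is not attained
on the row of ones. -/
theorem exists_query_separates [Fintype U] {b b' : Fin d → Bool} {h : ℝ} (hh : 0 ≤ h)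
    (hrigid : ∀ χ, IsPartialColoring S χ →
      ∃ i, h < |∑ u, appendOnes (queryMatrix Q) i u * χ u|)
    (hf : Function.Injective f) (hS : ∀ k, f k ∈ S) (hb : S.card ≤ 16 * hammingDist b b')
    (p : U) (hdn : d ≤ n) :
    ∃ j, h / n ≤ |queryValue (Q j) (pairDataset f p hdn b) -
      queryValue (Q j) (pairDataset f p hdn b')| := by
  classical
  obtain ⟨i, hi⟩ := hrigid _ (isPartialColoring_pairColoring hf hS hb)
  rw [sum_mul_pairColoring] at hi
  revert hi
  refine Fin.lastCases (fun hi => ?_) (fun j hi => ⟨j, ?_⟩) i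
  · simp only [appendOnes_last, sub_self, Finset.sum_const_zero, abs_zero] at hi
    exact absurd hi hh.not_gt
  · rw [appendOnes_castSucc] at hi
    rw [queryValue_pairDataset_sub, abs_div, Nat.abs_cast]
    gcongr

theorem exists_error_of_two_le_hdiscStar [Finite U] (hn : 3 ≤ n) (hH : 2 ≤ hdiscStar Q n)
    {M : Dataset U n → Measure (Fin m → ℝ)} [∀ x, IsProbabilityMeasure (M x)]
    (hM : IsDP (1 / 8) (1 / 8) M) :
    ∃ x, ENNReal.ofReal (1 / 200 * (hdiscStar Q n / (n * Real.log n))) ≤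
      ∫⁻ a, ENNReal.ofReal (maxError Q a x) ∂(M x) := by
  have := Fintype.ofFinite U
  obtain ⟨S, hS2, hSn, hrigid⟩ := exists_rigid_set hn hH
  have hlog : 1 < Real.log n := one_lt_log (by exact_mod_cast hn)
  have hd : 0 < S.card / 2 := by lia
  have hdn : S.card / 2 ≤ n := by lia
  obtain ⟨φ⟩ : Nonempty (Fin (S.card / 2) × Bool ↪ S) := by
    refine Function.Embedding.nonempty_of_card_le ?_
    simp only [Fintype.card_prod, Fintype.card_fin, Fintype.card_bool, Fintype.card_coe]
    lia
  have hinj : Function.Injective fun k => (φ k : U) := Subtype.val_injective.comp φ.injective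
  obtain ⟨x, hx⟩ := exists_error_of_separated hd hM
    (neighboring_pairDataset hinj (φ (⟨0, hd⟩, false)) hdn) fun b b' hbb =>
      exists_query_separates (by positivity) hrigid hinj (fun k => (φ k).2) (by lia) _ hdn
  refine ⟨x, le_trans (le_of_eq ?_) hx⟩
  congr 1
  field

theorem two_le_card_of_two_le_hdiscStar [Fintype U] (hn : 3 ≤ n) (hH : 2 ≤ hdiscStar Q n) :
    2 ≤ Fintype.card U := by
  obtain ⟨S, hS, -⟩ := exists_rigid_set hn hH
  exact hS.trans S.card_le_univ

end

section

variable {U : Type u} {n m : ℕ} {ε δ β : ℝ}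

theorem exists_private [Fintype U] {δ₀ : ℝ} (hδ₀ : δ₀ < 1) (hn : 3 ≤ n) (hm : 1 ≤ m) (hε : 0 < ε)
    (hε1 : ε ≤ 1) (hδ : 0 < δ) (hδδ₀ : δ ≤ δ₀) (hβ : 0 < β) (hβ1 : β < 1) :
    ∃ M : InteractiveAlgorithm U n, M.IsPrivate m ε δ ∧
      ∀ (A : AdaptiveAnalyst U) (x : Dataset U n), ENNReal.ofReal (1 - β) ≤ trans M A m x
        {t | maxError (fun j => (t j).1) (fun j => (t j).2) x ≤ rateConst δ₀ *
          errorRate (hdiscStar (fun j => (t j).1) n) (Fintype.card U) n m ε δ β ^ (2 / 3 : ℝ)} := by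
  rcases lt_or_ge (Fintype.card U) 2 with hU | hU
  · have : Subsingleton U := Fintype.card_le_one_iff_subsingleton.1 (by lia)
    refine exists_private_of_subsingleton hβ fun t => ?_
    have hlog : Real.log (Fintype.card U) = 0 := by interval_cases Fintype.card U <;> simp
    simp [errorRate, hlog]
  · exact exists_private_of_two_le_card hU hδ₀ hn hm hε hε1 hδ hδδ₀ hβ hβ1

theorem errorRate_sq_mul {H : ℝ} (hH : 0 < H) {N : ℕ} (hN : 2 ≤ N) (hn : 3 ≤ n)
    (hm : 1 ≤ m) (hε : 0 < ε) (hδ : 0 < δ) (hδ1 : δ < 1) (hβ : 0 < β) (hβ1 : β < 1) :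
    errorRate H N n m ε δ β ^ 2 *
      (ε ^ 2 * H ^ 2 / (n * Real.log N * Real.log (1 / δ) *
        Real.log (m * Real.log n / β) ^ 2 * Real.log n ^ 2)) = (H / n) ^ 3 := by
  have : (0 : ℝ) < n := by positivity
  have hlogn : 0 < Real.log n := zero_lt_one.trans (one_lt_log (by exact_mod_cast hn))
  have hlogN : 0 < Real.log N := Real.log_pos (by exact_mod_cast hN)
  have hlogδ := log_one_div_pos hδ hδ1
  have hlogβ := log_rate_pos hn hm hβ hβ1
  rw [errorRate, div_pow, mul_pow, mul_pow, Real.sq_sqrt (by positivity)]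
  field

theorem div_eq_errorRate_rpow_mul {H : ℝ} (hH : 0 < H) {N : ℕ} (hN : 2 ≤ N) (hn : 3 ≤ n)
    (hm : 1 ≤ m) (hε : 0 < ε) (hδ : 0 < δ) (hδ1 : δ < 1) (hβ : 0 < β) (hβ1 : β < 1) :
    H / n = errorRate H N n m ε δ β ^ (2 / 3 : ℝ) *
      (ε ^ 2 * H ^ 2 / (n * Real.log N * Real.log (1 / δ) *
        Real.log (m * Real.log n / β) ^ 2 * Real.log n ^ 2)) ^ (1 / 3 : ℝ) := by
  have hlogδ := log_one_div_pos hδ hδ1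
  have hlogβ := log_rate_pos hn hm hβ hβ1
  have hF : 0 ≤ errorRate H N n m ε δ β := by
    rw [errorRate]
    positivity
  have hsq : errorRate H N n m ε δ β ^ (2 / 3 : ℝ) =
      (errorRate H N n m ε δ β ^ 2) ^ (1 / 3 : ℝ) := by
    rw [← Real.rpow_natCast_mul hF]
    norm_num
  have hcube : ((H / n) ^ 3) ^ (1 / 3 : ℝ) = H / n := by
    rw [← Real.rpow_natCast_mul (by positivity)]
    norm_num
  rw [hsq, ← Real.mul_rpow (by positivity) (by positivity),
    errorRate_sq_mul hH hN hn hm hε hδ hδ1 hβ hβ1, hcube]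

end

end

end OnlineRelease

theorem mainTheorem4 :
    -- the algorithm: privacy, and accuracy for adaptively chosen counting queries
    (∃ k : ℕ, ∀ δ₀ : ℝ, 0 < δ₀ → δ₀ < 1 → ∃ C : ℝ, 0 < C ∧
      ∀ (U : Type u) [Fintype U] (n m : ℕ) (ε δ β : ℝ),
        3 ≤ n → 1 ≤ m → 0 < ε → ε ≤ 1 → 0 < δ → δ ≤ δ₀ → 0 < β → β < 1 →
        ∃ M : OnlineRelease.InteractiveAlgorithm U n,
          M.IsPrivate m ε δ ∧
          ∀ (A : OnlineRelease.AdaptiveAnalyst U) (x : OnlineRelease.Dataset U n),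
            ENNReal.ofReal (1 - β) ≤
              OnlineRelease.trans M A m x
                {t | OnlineRelease.maxError (fun j => (t j).1) (fun j => (t j).2) x ≤
                  C * (1 + Real.log (Real.log n)) ^ k *
                    OnlineRelease.errorRate (OnlineRelease.hdiscStar (fun j => (t j).1) n)
                      (Fintype.card U) n m ε δ β ^ (2 / 3 : ℝ)}) ∧
    -- competitiveness: the offline lower bound, and its ratio to the error of the algorithm
    (∃ c : ℝ, 0 < c ∧
      ∀ (U : Type u) [Fintype U] (n m : ℕ) (Q : Fin m → OnlineRelease.BoolQuery U),
        3 ≤ n → 1 ≤ m → 2 ≤ OnlineRelease.hdiscStar Q n →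
        (∀ M : OnlineRelease.Dataset U n → MeasureTheory.Measure (Fin m → ℝ),
          (∀ x, MeasureTheory.IsProbabilityMeasure (M x)) →
          OnlineRelease.IsDP (1 / 8) (1 / 8) M →
          ∃ x : OnlineRelease.Dataset U n,
            ENNReal.ofReal (c * (OnlineRelease.hdiscStar Q n / (n * Real.log n))) ≤
              ∫⁻ a, ENNReal.ofReal (OnlineRelease.maxError Q a x) ∂(M x)) ∧
        ∀ ε δ β : ℝ, 0 < ε → 0 < δ → δ < 1 → 0 < β → β < 1 →
          OnlineRelease.hdiscStar Q n / n =
            OnlineRelease.errorRate (OnlineRelease.hdiscStar Q n) (Fintype.card U) n m ε δ β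
                ^ (2 / 3 : ℝ) *
              (ε ^ 2 * OnlineRelease.hdiscStar Q n ^ 2 /
                (n * Real.log (Fintype.card U) * Real.log (1 / δ) *
                  Real.log (m * Real.log n / β) ^ 2 * Real.log n ^ 2)) ^ (1 / 3 : ℝ)) := by
  refine ⟨⟨0, fun δ₀ hδ₀ hδ₀1 => ⟨OnlineRelease.rateConst δ₀,
    OnlineRelease.rateConst_pos hδ₀ hδ₀1, ?_⟩⟩, 1 / 200, by norm_num, ?_⟩
  · intro U _ n m ε δ β hn hm hε hε1 hδ hδδ₀ hβ hβ1
    simp only [pow_zero, mul_one]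
    exact OnlineRelease.exists_private hδ₀1 hn hm hε hε1 hδ hδδ₀ hβ hβ1
  · intro U _ n m Q hn hm hH
    refine ⟨fun M hM hDP => OnlineRelease.exists_error_of_two_le_hdiscStar hn hH hDP,
      fun ε δ β hε hδ hδ1 hβ hβ1 => ?_⟩
    exact OnlineRelease.div_eq_errorRate_rpow_mul (by linarith)
      (OnlineRelease.two_le_card_of_two_le_hdiscStar hn hH) hn hm hε hδ hδ1 hβ hβ1
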